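/- Let $\mathbb D=\{z\in\mathbb C:|z|<1\}$ and let $\mathcal A$ be the class of functions $f$ analytic in $\mathbb D$ with $f(0)=0$, $f'(0)=1$. For $\alpha,\gamma\ge 0$ and $\beta<1$, let $W_\beta(\alpha,\gamma)$ be the class of all $f\in\mathcal A$ for which there is $\phi\in\mathbb R$ with $$\operatorname{Re}\Big(e^{i\phi}\Big((1-\alpha+2\gamma)\frac{f(z)}{z}+(\alpha-2\gamma)f'(z)+\gamma z f''(z)-\beta\Big)\Big)>0\qquad(z\in\mathbb D),$$ where $f(z)/z$ is read as $f'(0)$ at $z=0$. For $0\le\xi\le1$, let $M(\xi)$ be the class of all $f\in\mathcal A$ with $$\operatorname{Re}\frac{\xi z(zf'(z))'+(1-\xi)zf'(z)}{\xi zf'(z)+(1-\xi)f(z)}>0\qquad(z\in\mathbb D),$$ where the denominator is required not to vanish for $z\ne0$ and the quotient is read as $1$ at $z=0$. **Theorem.** Let $0\le\xi\le1$ and $\nu\ge\mu\ge1$, and let $\alpha,\gamma$ be given by $\mu\nu=\gamma$ and $\mu+\nu=\alpha-\gamma$. Let $g$ and $q$ be the solutions, continuous on $[0,1)$, of the initial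 value problems $$\frac{d}{dt}\big(t^{1/\nu}(1+g(t))\big)=\frac{2}{\mu\nu}\,t^{1/\nu-1}\int_0^1\frac{s^{1/\mu-1}}{(1+st)^2}\,ds\quad(0<t<1),\qquad g(0)=1,$$ $$\frac{d}{dt}\big(t^{1/\nu}q(t)\big)=\frac{1}{\mu\nu}\,t^{1/\nu-1}\int_0^1 s^{1/\mu-1}\frac{1-st}{(1+st)^3}\,ds\quad(0<t<1),\qquad q(0)=1.$$ Let $$-1<c\le\min\left(1+\frac1\mu-\frac1\nu,\ \frac{1+\frac1\mu-\xi}{1+2\xi}\right),$$ put $\lambda(t)=(1+c)t^c$, and let $\beta<1$ satisfy $$\frac{\beta}{1-\beta}=-\int_0^1\lambda(t)\big[(1-\xi)g(t)+\xi(2q(t)-1)\big]\,dt.$$ If $f\in W_\beta(\alpha,\gamma)$, then the Bernardi transform $$F(z)=(1+c)\int_0^1t^{c-1}f(tz)\,dt\qquad(z\in\mathbb D)$$ belongs to $M(\xi)$. -/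

import Mathlib

open Filter Topology MeasureTheory

noncomputable section

/-- The class `𝒜`: functions analytic in the open unit disc with `f 0 = 0` and `f' 0 = 1`. -/
structure NormalizedAnalytic (f : ℂ → ℂ) : Prop where
  differentiableOn : DifferentiableOn ℂ f (Metric.ball 0 1)
  map_zero : f 0 = 0
  deriv_zero : deriv f 0 = 1

/-- The class `W_β(α, γ)`. For `f 0 = 0`, the function `dslope f 0` is `f z / z` for `z ≠ 0`,
and takes the limit value `f' 0` at `z = 0`. -/
def classW (α γ β : ℝ) : Set (ℂ → ℂ) :=
  {f | NormalizedAnalytic f ∧ ∃ φ : ℝ, ∀ z ∈ Metric.ball (0 : ℂ) 1,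
    0 < (Complex.exp (Complex.I * φ) *
      ((1 - α + 2 * γ) * dslope f 0 z + (α - 2 * γ) * deriv f z
        + γ * z * deriv (deriv f) z - β)).re}

/-- The Pascu class `M(ξ)` of `ξ`-convex functions. The quotient has a removable singularity
with value `1` at `z = 0`, so the condition is imposed at `z ≠ 0`; as `w / 0 = 0`, the strict
inequality includes that the denominator does not vanish there. -/
def classM (ξ : ℝ) : Set (ℂ → ℂ) :=
  {f | NormalizedAnalytic f ∧ ∀ z ∈ Metric.ball (0 : ℂ) 1, z ≠ 0 →
    0 < ((ξ * z * deriv (fun w => w * deriv f w) z + (1 - ξ) * z * deriv f z) /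
      (ξ * z * deriv f z + (1 - ξ) * f z)).re}

/-- The weight `λ(t) = (1 + c) t ^ c`. -/
def bernardiWeight (c t : ℝ) : ℝ := (1 + c) * t ^ c

/-- The Bernardi operator, `z ↦ (1 + c) ∫₀¹ t ^ (c - 1) f (t z) dt`. -/
def bernardiOperator (c : ℝ) (f : ℂ → ℂ) (z : ℂ) : ℂ :=
  (1 + c) * ∫ t in (0 : ℝ)..1, ((t ^ (c - 1) : ℝ) : ℂ) * f (t * z)

/-- Right-hand side of the differential equation for `g`. -/
def gRHS (μ ν t : ℝ) : ℝ :=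
  2 / (μ * ν) * t ^ (1 / ν - 1) * ∫ s in (0 : ℝ)..1, s ^ (1 / μ - 1) / (1 + s * t) ^ 2

/-- Right-hand side of the differential equation for `q`. -/
def qRHS (μ ν t : ℝ) : ℝ :=
  1 / (μ * ν) * t ^ (1 / ν - 1) *
    ∫ s in (0 : ℝ)..1, s ^ (1 / μ - 1) * ((1 - s * t) / (1 + s * t) ^ 3)

/-- `g` solves `(t ^ (1/ν) (1 + g t))' = gRHS μ ν t` on `(0, 1)` with `g 0 = 1`. -/
structure SolvesG (μ ν : ℝ) (g : ℝ → ℝ) : Prop where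
  continuousOn : ContinuousOn g (Set.Ico 0 1)
  init : g 0 = 1
  ode : ∀ t ∈ Set.Ioo (0 : ℝ) 1,
    HasDerivAt (fun t => t ^ (1 / ν) * (1 + g t)) (gRHS μ ν t) t

/-- `q` solves `(t ^ (1/ν) q t)' = qRHS μ ν t` on `(0, 1)` with `q 0 = 1`. -/
structure SolvesQ (μ ν : ℝ) (q : ℝ → ℝ) : Prop where
  continuousOn : ContinuousOn q (Set.Ico 0 1)
  init : q 0 = 1
  ode : ∀ t ∈ Set.Ioo (0 : ℝ) 1,
    HasDerivAt (fun t => t ^ (1 / ν) * q t) (qRHS μ ν t) t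

/-- The function `g`; it is the unique solution of its initial value problem, see
`solvesG_gFun` and `SolvesG.eqOn`. -/
def gFun (μ ν t : ℝ) : ℝ :=
  2 / (μ * ν) * (∫ x in (0 : ℝ)..1, x ^ (1 / ν - 1) *
    ∫ s in (0 : ℝ)..1, s ^ (1 / μ - 1) / (1 + s * (t * x)) ^ 2) - 1

/-- The function `q`; it is the unique solution of its initial value problem, see
`solvesQ_qFun` and `SolvesQ.eqOn`. -/
def qFun (μ ν t : ℝ) : ℝ :=
  1 / (μ * ν) * ∫ x in (0 : ℝ)..1, x ^ (1 / ν - 1) *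
    ∫ s in (0 : ℝ)..1, s ^ (1 / μ - 1) * ((1 - s * (t * x)) / (1 + s * (t * x)) ^ 3)

theorem continuousOn_powerAverage {κ : ℝ} (hκ : 0 < κ) {φ : ℝ → ℝ}
    (hφ : ContinuousOn φ (Set.Ici 0)) :
    ContinuousOn (fun t => ∫ x in (0 : ℝ)..1, x ^ (κ - 1) * φ (t * x)) (Set.Ici 0) := by
  have hψ : Continuous (fun u : ℝ => φ (max u 0)) :=
    hφ.comp_continuous (by fun_prop) (fun u => Set.mem_Ici.mpr (le_max_right _ _))
  have hpow : IntervalIntegrable (fun x : ℝ => x ^ (κ - 1)) volume 0 1 :=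
    intervalIntegral.intervalIntegrable_rpow' (by linarith)
  have key : Continuous (fun t => ∫ x in (0 : ℝ)..1, x ^ (κ - 1) * φ (max (t * x) 0)) := by
    rw [continuous_iff_continuousAt]
    intro t₀
    obtain ⟨C, hC⟩ := (isCompact_Icc (a := -(|t₀| + 1)) (b := |t₀| + 1)).exists_bound_of_continuousOn
      hψ.continuousOn
    refine intervalIntegral.continuousAt_of_dominated_interval
      (bound := fun x => C * x ^ (κ - 1)) ?_ ?_ (hpow.const_mul C) ?_
    · refine Eventually.of_forall fun t => ?_
      refine AEStronglyMeasurable.mul ?_ ?_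
      · exact (by fun_prop : Measurable (fun x : ℝ => x ^ (κ - 1))).aestronglyMeasurable
      · exact (hψ.comp (by fun_prop : Continuous fun x : ℝ => t * x)).aestronglyMeasurable
    · filter_upwards [Metric.ball_mem_nhds t₀ one_pos] with t ht
      refine Eventually.of_forall fun x hx => ?_
      rw [Set.uIoc_of_le zero_le_one] at hx
      have h1 : |t| ≤ |t₀| + 1 := by
        rw [Metric.mem_ball, Real.dist_eq] at ht
        have := abs_add_le (t - t₀) t₀
        simp only [sub_add_cancel] at this
        linarith
      have h2 : |t * x| ≤ |t₀| + 1 := by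
        rw [abs_mul, abs_of_pos hx.1]
        nlinarith [abs_nonneg t, hx.2]
      have h3 := hC (t * x) (abs_le.mp h2)
      rw [norm_mul, mul_comm, Real.norm_of_nonneg (Real.rpow_nonneg hx.1.le _)]
      exact mul_le_mul_of_nonneg_right h3 (Real.rpow_nonneg hx.1.le _)
    · refine Eventually.of_forall fun x _ => ?_
      exact (continuous_const.mul
        (hψ.comp (by fun_prop : Continuous fun t : ℝ => t * x))).continuousAt
  refine key.continuousOn.congr fun t ht => ?_
  refine intervalIntegral.integral_congr fun x hx => ?_
  rw [Set.uIcc_of_le zero_le_one] at hx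
  simp only [max_eq_left (mul_nonneg (Set.mem_Ici.mp ht) hx.1)]

theorem hasDerivAt_powerAverage {κ : ℝ} (hκ : 0 < κ) {φ : ℝ → ℝ}
    (hφ : ContinuousOn φ (Set.Ici 0)) {t : ℝ} (ht : 0 < t) :
    HasDerivAt (fun t => t ^ κ * ∫ x in (0 : ℝ)..1, x ^ (κ - 1) * φ (t * x))
      (t ^ (κ - 1) * φ t) t := by
  have hint : IntervalIntegrable (fun x : ℝ => x ^ (κ - 1) * φ x) volume 0 t := by
    refine (intervalIntegral.intervalIntegrable_rpow' (by linarith)).mul_continuousOn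
      (hφ.mono fun x hx => ?_)
    rw [Set.uIcc_of_le ht.le] at hx
    exact hx.1
  have hcont : ContinuousOn (fun x : ℝ => x ^ (κ - 1) * φ x) (Set.Ioi 0) :=
    ContinuousOn.mul (fun x hx => (Real.continuousAt_rpow_const x _
      (Or.inl (ne_of_gt hx))).continuousWithinAt) (hφ.mono Set.Ioi_subset_Ici_self)
  have hmeas : StronglyMeasurableAtFilter (fun x : ℝ => x ^ (κ - 1) * φ x) (𝓝 t) :=
    hcont.stronglyMeasurableAtFilter isOpen_Ioi t ht
  have hd := intervalIntegral.integral_hasDerivAt_right hint hmeas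
    (hcont.continuousAt (Ioi_mem_nhds ht))
  refine hd.congr_of_eventuallyEq ?_
  filter_upwards [Ioi_mem_nhds ht] with u hu
  have hu : 0 < u := hu
  have h := intervalIntegral.mul_integral_comp_mul_left (a := 0) (b := 1)
    (f := fun x : ℝ => x ^ (κ - 1) * φ x) (c := u)
  rw [mul_zero, mul_one] at h
  rw [← h, ← intervalIntegral.integral_const_mul, ← intervalIntegral.integral_const_mul]
  refine intervalIntegral.integral_congr fun x hx => ?_
  rw [Set.uIcc_of_le zero_le_one] at hx
  rw [Real.mul_rpow hu.le hx.1, Real.rpow_sub_one hu.ne']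
  field_simp

theorem powerAverage_const {κ : ℝ} (hκ : 0 < κ) :
    ∫ x in (0 : ℝ)..1, x ^ (κ - 1) = 1 / κ := by
  rw [integral_rpow (Or.inl (by linarith))]
  simp [Real.zero_rpow hκ.ne']

theorem continuousOn_gInner {μ : ℝ} (hμ : 0 < μ) :
    ContinuousOn (fun t : ℝ => ∫ s in (0 : ℝ)..1, s ^ (1 / μ - 1) / (1 + s * t) ^ 2)
      (Set.Ici 0) := by
  have h : ContinuousOn (fun u : ℝ => 1 / (1 + u) ^ 2) (Set.Ici 0) := by
    refine ContinuousOn.div (by fun_prop) (by fun_prop) fun u hu => ?_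
    have : (0 : ℝ) ≤ u := hu
    positivity
  refine (continuousOn_powerAverage (one_div_pos.mpr hμ) h).congr fun t _ => ?_
  simp only [mul_one_div, mul_comm t]

theorem continuousOn_qInner {μ : ℝ} (hμ : 0 < μ) :
    ContinuousOn (fun t : ℝ =>
      ∫ s in (0 : ℝ)..1, s ^ (1 / μ - 1) * ((1 - s * t) / (1 + s * t) ^ 3)) (Set.Ici 0) := by
  have h : ContinuousOn (fun u : ℝ => (1 - u) / (1 + u) ^ 3) (Set.Ici 0) := by
    refine ContinuousOn.div (by fun_prop) (by fun_prop) fun u hu => ?_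
    have : (0 : ℝ) ≤ u := hu
    positivity
  refine (continuousOn_powerAverage (one_div_pos.mpr hμ) h).congr fun t _ => ?_
  simp only [mul_comm t]

theorem solvesG_gFun {μ ν : ℝ} (hμ : 0 < μ) (hν : 0 < ν) : SolvesG μ ν (gFun μ ν) where
  continuousOn := by
    have h := continuousOn_powerAverage (one_div_pos.mpr hν) (continuousOn_gInner hμ)
    exact ((continuousOn_const.mul h).sub continuousOn_const).mono Set.Ico_subset_Ici_self
  init := by
    simp only [gFun, zero_mul, mul_zero, add_zero, one_pow, div_one,
      powerAverage_const (one_div_pos.mpr hμ), intervalIntegral.integral_mul_const,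
      powerAverage_const (one_div_pos.mpr hν)]
    field_simp
    norm_num
  ode t ht := by
    have h := (hasDerivAt_powerAverage (one_div_pos.mpr hν) (continuousOn_gInner hμ)
      ht.1).const_mul (2 / (μ * ν))
    rw [← mul_assoc] at h
    refine h.congr_of_eventuallyEq (Eventually.of_forall fun u => ?_)
    simp only [gFun]
    ring

theorem solvesQ_qFun {μ ν : ℝ} (hμ : 0 < μ) (hν : 0 < ν) : SolvesQ μ ν (qFun μ ν) where
  continuousOn := by
    have h := continuousOn_powerAverage (one_div_pos.mpr hν) (continuousOn_qInner hμ)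
    exact (continuousOn_const.mul h).mono Set.Ico_subset_Ici_self
  init := by
    simp only [qFun, zero_mul, mul_zero, add_zero, sub_zero, one_pow, div_one, mul_one,
      powerAverage_const (one_div_pos.mpr hμ), intervalIntegral.integral_mul_const,
      powerAverage_const (one_div_pos.mpr hν)]
    field_simp
  ode t ht := by
    have h := (hasDerivAt_powerAverage (one_div_pos.mpr hν) (continuousOn_qInner hμ)
      ht.1).const_mul (1 / (μ * ν))
    rw [← mul_assoc] at h
    refine h.congr_of_eventuallyEq (Eventually.of_forall fun u => ?_)
    simp only [qFun]
    ring

theorem eqOn_of_hasDerivAt_rpow_mul {κ : ℝ} (hκ : 0 < κ) {R y₁ y₂ : ℝ → ℝ}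
    (c₁ : ContinuousOn y₁ (Set.Ico 0 1)) (c₂ : ContinuousOn y₂ (Set.Ico 0 1))
    (h₁ : ∀ t ∈ Set.Ioo (0 : ℝ) 1, HasDerivAt (fun t => t ^ κ * y₁ t) (R t) t)
    (h₂ : ∀ t ∈ Set.Ioo (0 : ℝ) 1, HasDerivAt (fun t => t ^ κ * y₂ t) (R t) t)
    (h₀ : y₁ 0 = y₂ 0) : Set.EqOn y₁ y₂ (Set.Ico 0 1) := by
  intro t ht
  rcases ht.1.eq_or_lt with rfl | h0
  · exact h₀
  have hsub : Set.Icc 0 t ⊆ Set.Ico (0 : ℝ) 1 := fun x hx => ⟨hx.1, hx.2.trans_lt ht.2⟩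
  have hr : Continuous (fun x : ℝ => x ^ κ) :=
    Real.continuous_rpow_const hκ.le
  have hcont : ContinuousOn (fun x => x ^ κ * y₁ x - x ^ κ * y₂ x) (Set.Icc 0 t) :=
    (hr.continuousOn.mul (c₁.mono hsub)).sub (hr.continuousOn.mul (c₂.mono hsub))
  obtain ⟨x, hx, hslope⟩ := exists_hasDerivAt_eq_slope
    (fun x => x ^ κ * y₁ x - x ^ κ * y₂ x) (fun _ => 0) h0 hcont fun x hx => by
      have := (h₁ x ⟨hx.1, hx.2.trans ht.2⟩).sub (h₂ x ⟨hx.1, hx.2.trans ht.2⟩)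
      rwa [sub_self] at this
  simp only [Real.zero_rpow hκ.ne', zero_mul, sub_zero] at hslope
  have h3 : t ^ κ * (y₁ t - y₂ t) = 0 := by
    have := (div_eq_zero_iff.mp hslope.symm).resolve_right h0.ne'
    linarith
  have h4 := (mul_eq_zero.mp h3).resolve_left (Real.rpow_pos_of_pos h0 κ).ne'
  linarith

theorem SolvesG.eqOn {μ ν : ℝ} (hν : 0 < ν) {g₁ g₂ : ℝ → ℝ} (h₁ : SolvesG μ ν g₁)
    (h₂ : SolvesG μ ν g₂) : Set.EqOn g₁ g₂ (Set.Ico 0 1) := fun t ht => by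
  have := eqOn_of_hasDerivAt_rpow_mul (one_div_pos.mpr hν)
    (continuousOn_const.add h₁.continuousOn) (continuousOn_const.add h₂.continuousOn)
    h₁.ode h₂.ode (by simp only [Pi.add_apply, h₁.init, h₂.init]) ht
  simpa using this

theorem SolvesQ.eqOn {μ ν : ℝ} (hν : 0 < ν) {q₁ q₂ : ℝ → ℝ} (h₁ : SolvesQ μ ν q₁)
    (h₂ : SolvesQ μ ν q₂) : Set.EqOn q₁ q₂ (Set.Ico 0 1) :=
  eqOn_of_hasDerivAt_rpow_mul (one_div_pos.mpr hν) h₁.continuousOn h₂.continuousOn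
    h₁.ode h₂.ode (by rw [h₁.init, h₂.init])

end

/-! With `G = ξ z F' + (1 - ξ) F`, the claim is that `z G' / G` has positive real part, which holds
at `z` as soon as `(1 - ε)/2 · G + (1 + ε)/2 · z G'` is nonzero there for all `‖ε‖ ≤ 1`
(`re_div_pos_of_forall_ne_zero`). Divided by `z`, this pencil is the Hadamard product of `H`, the
expression defining `classW`, with `K = ∑ k_m z^m`, where `k_m = pascuCoeff m · (1 + m (1 + ε)/2)`.
If `Re K > b` and `Re Q > 0`, then `Re (K * Q) > (2b - 1) Re q₀` (`lt_re_tsum_convolution`, by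
Parseval). With `Q = e^{iφ} (H - β)` and `b = (1 - β/(1 - β))/2` this bound rules out a zero.

It remains to show `Re K > b`. The numbers `(1 + ε)/2` fill the convex hull of the circle of points
`Re(u) u`, `|u| = 1`, so `ε` may be replaced by such a `u`. The minimum over `u` and over `|z| = r`
is then attained at `u = 1`, `z = -r` (`pascuCoeff_extremal`). That value strictly decreases in `r`,
and at `r = 1` it equals `b` by the choice of `β` (`integral_bernardiWeight`).

Multipliers with this minimum property form a cone stable under division by `m + κ`, `κ > 0`. Hence
everything follows from the single multiplier `1/(m+1) - 1/(m+3)`, that is, from the nonnegativity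
of `∫ (1 - t²) kernelGap(r t) dt`. The integrand is bounded below by means of an explicit
nonnegative `potential`, which reduces the matter to a polynomial inequality. -/

/-! ### Polynomial inequalities. -/

/-- First Bernstein coefficient of `criticalPoly v` on `[0, 2]`, up to positive factors. -/
theorem criticalPoly_bernstein_one {v : ℝ} (h0 : 0 ≤ v) (h1 : v ≤ 1) :
    0 ≤ 128 - 864 * v + 2384 * v ^ 2 - 2376 * v ^ 3 + 1092 * v ^ 4 - 196 * v ^ 5 - 2 * v ^ 6 := by
  -- Trading the terms in `v ^ 5` and `v ^ 6` for `v ^ 4` leaves a quartic to be bounded by squares.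
  have h5 : v ^ 5 ≤ v ^ 4 := pow_le_pow_of_le_one h0 h1 (by norm_num)
  have h6 : v ^ 6 ≤ v ^ 4 := pow_le_pow_of_le_one h0 h1 (by norm_num)
  nlinarith [sq_nonneg (v * (v - 1)), sq_nonneg (v ^ 2 - v * 1.3 + 0.2), sq_nonneg (v - 0.3),
    sq_nonneg (v ^ 2 - 0.1), sq_nonneg (v ^ 2 - v * 1.3)]

/-- Second Bernstein coefficient of `criticalPoly v` on `[0, 2]`, up to positive factors. -/
theorem criticalPoly_bernstein_two {v : ℝ} (h0 : 0 ≤ v) (h1 : v ≤ 1) :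
    0 ≤ 3 * v ^ 3 * (8 + 148 * v - 60 * v ^ 2)
      + 4 * ((64 - 432 * v + 1192 * v ^ 2 - 1200 * v ^ 3 + 324 * v ^ 4 - 8 * v ^ 5 - v ^ 6)
        + (832 - 1984 * v + 1424 * v ^ 2 - 208 * v ^ 3 - 56 * v ^ 4 + 12 * v ^ 5)) := by
  have h5 : v ^ 5 ≤ v ^ 4 := pow_le_pow_of_le_one h0 h1 (by norm_num)
  have h6 : v ^ 6 ≤ v ^ 4 := pow_le_pow_of_le_one h0 h1 (by norm_num)
  have h3 : 0 ≤ v ^ 3 := by positivity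
  nlinarith [sq_nonneg (v * (v - 1)), sq_nonneg (v ^ 2 - v), sq_nonneg (v - 1),
    sq_nonneg (v ^ 2 - v + 1)]

/-- Third Bernstein coefficient of `criticalPoly v` on `[0, 2]`, up to positive factors. -/
theorem criticalPoly_bernstein_three {v : ℝ} (h0 : 0 ≤ v) (h1 : v ≤ 1) :
    0 ≤ v ^ 5 * (8 + 148 * v - 60 * v ^ 2)
      + 2 * (v ^ 2 *
        (64 - 432 * v + 1192 * v ^ 2 - 1200 * v ^ 3 + 324 * v ^ 4 - 8 * v ^ 5 - v ^ 6))
      + 4 * (v ^ 2 * (832 - 1984 * v + 1424 * v ^ 2 - 208 * v ^ 3 - 56 * v ^ 4 + 12 * v ^ 5))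
      + 8 * (128 - 320 * v - 80 * v ^ 2 + 768 * v ^ 3 - 700 * v ^ 4 + 224 * v ^ 5
        - 24 * v ^ 6) := by
  have h7 : v ^ 7 ≤ v ^ 6 := pow_le_pow_of_le_one h0 h1 (by norm_num)
  have h8 : v ^ 8 ≤ v ^ 6 := pow_le_pow_of_le_one h0 h1 (by norm_num)
  nlinarith [sq_nonneg (v * (v - 1)), sq_nonneg (v ^ 2 - v), sq_nonneg (v - 1),
    sq_nonneg (v ^ 2 - v + 1), sq_nonneg (v ^ 3 - v), sq_nonneg (v ^ 3 - v ^ 2),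
    sq_nonneg (v ^ 3 - 1), pow_nonneg h0 5]

/-- The discriminant vanishes, so `d` times the form is the square of `d p - y q`; if `d = 0` then
`y = 0` as well. -/
theorem quadForm_nonneg {d e y : ℝ} (hd : 0 ≤ d) (he : 0 ≤ e) (hy : y ^ 2 = d * e) (p q : ℝ) :
    0 ≤ d * p ^ 2 - 2 * y * p * q + e * q ^ 2 := by
  rcases hd.eq_or_lt with rfl | hd
  · have : y = 0 := by simpa using hy
    subst this
    have := mul_nonneg he (sq_nonneg q)
    linarith
  · have h : 0 ≤ d * (d * p ^ 2 - 2 * y * p * q + e * q ^ 2) := by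
      have := sq_nonneg (d * p - y * q)
      nlinarith [congrArg (· * q ^ 2) hy]
    exact nonneg_of_mul_nonneg_right h hd

/-- Remainder left in the `S ^ 2` entry after completing the square; here `v = 1 - τ` and
`d = 1 - x`. -/
def criticalPoly (v d : ℝ) : ℝ :=
  v ^ 5 * (8 + 148 * v - 60 * v ^ 2)
    + d * (v ^ 2 * (64 - 432 * v + 1192 * v ^ 2 - 1200 * v ^ 3 + 324 * v ^ 4 - 8 * v ^ 5 - v ^ 6))
    + d ^ 2 * (v ^ 2 * (832 - 1984 * v + 1424 * v ^ 2 - 208 * v ^ 3 - 56 * v ^ 4 + 12 * v ^ 5))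
    + d ^ 3 * (128 - 320 * v - 80 * v ^ 2 + 768 * v ^ 3 - 700 * v ^ 4 + 224 * v ^ 5 - 24 * v ^ 6)

theorem criticalPoly_nonneg {v d : ℝ} (hv0 : 0 ≤ v) (hv1 : v ≤ 1) (hd0 : 0 ≤ d) (hd2 : d ≤ 2) :
    0 ≤ criticalPoly v d := by
  have h2 : 0 ≤ 2 - d := by linarith
  have h0 : 0 ≤ 8 + 148 * v - 60 * v ^ 2 := by nlinarith
  -- The four products add up to `8 * criticalPoly v d`, expanded in the basis `(2 - d)^(3-k) d^k`.
  have e0 := mul_nonneg (pow_nonneg h2 3) (mul_nonneg (pow_nonneg hv0 5) h0)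
  have e1 := mul_nonneg (mul_nonneg (mul_nonneg (pow_nonneg h2 2) hd0) (sq_nonneg v))
    (criticalPoly_bernstein_one hv0 hv1)
  have e2 := mul_nonneg (mul_nonneg (mul_nonneg h2 (sq_nonneg d)) (sq_nonneg v))
    (criticalPoly_bernstein_two hv0 hv1)
  have e3 := mul_nonneg (pow_nonneg hd0 3) (criticalPoly_bernstein_three hv0 hv1)
  unfold criticalPoly
  linarith

/-! ### The kernel gap and its potential. -/

/-- `|1 - τ e^{iθ}| ^ 2` with `x = cos θ`. -/
def sqDist (x τ : ℝ) : ℝ := 1 - 2 * τ * x + τ ^ 2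

theorem sqDist_pos {x τ : ℝ} (hx : x ≤ 1) (h0 : 0 ≤ τ) (h1 : τ < 1) : 0 < sqDist x τ := by
  have : 0 < (1 - τ) ^ 2 := pow_pos (by linarith) 2
  unfold sqDist
  nlinarith

/-- Excess of the kernel at `τ (x + i y)` over its value for the extremal direction. -/
noncomputable def kernelGap (S C x y τ : ℝ) : ℝ :=
  S ^ 2 * ((1 - τ * x) / sqDist x τ - 1 / (1 + τ) ^ 2)
    + C ^ 2 * ((1 - 2 * τ * x + τ ^ 2 * (2 * x ^ 2 - 1)) / sqDist x τ ^ 2 - 1 / (1 + τ) ^ 2)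
    - C * S * (τ * (1 - τ ^ 2) * y / sqDist x τ ^ 2)

/-- Up to `(τ (1 - τ))²` this is the form of `quadForm_nonneg` in `S (1 + τ)/4` and `C`, with `d = 1
- x`, `e = 1 + x`; it is degenerate because `y² = 1 - x²`. -/
noncomputable def potentialNum (S C x y τ : ℝ) : ℝ :=
  (τ * (1 - τ)) ^ 2 * (S ^ 2 * (1 - x) * (1 + τ) ^ 2 / 16 + C ^ 2 * (1 + x)
    - C * S * y * (1 + τ) / 2)

/-- A nonnegative function whose derivative is at most `(1 - τ ^ 2) * kernelGap`. -/
noncomputable def potential (S C x y τ : ℝ) : ℝ :=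
  potentialNum S C x y τ / sqDist x τ + S ^ 2 * (5 / 8) * (τ ^ 3 * (1 - τ) ^ 4) / sqDist x τ ^ 2

noncomputable def potentialNumDeriv (S C x y τ : ℝ) : ℝ :=
  2 * (τ * (1 - τ)) * (1 - 2 * τ) * (S ^ 2 * (1 - x) * (1 + τ) ^ 2 / 16 + C ^ 2 * (1 + x)
    - C * S * y * (1 + τ) / 2) + (τ * (1 - τ)) ^ 2 * (S ^ 2 * (1 - x) * (1 + τ) / 8 - C * S * y / 2)

noncomputable def potentialDeriv (S C x y τ : ℝ) : ℝ :=
  (potentialNumDeriv S C x y τ * sqDist x τ - potentialNum S C x y τ * (2 * (τ - x)))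
      / sqDist x τ ^ 2
    + S ^ 2 * (5 / 8) * ((3 * τ ^ 2 * (1 - τ) ^ 4 - 4 * τ ^ 3 * (1 - τ) ^ 3) * sqDist x τ
      - τ ^ 3 * (1 - τ) ^ 4 * (4 * (τ - x))) / sqDist x τ ^ 3

theorem hasDerivAt_potential (S C x y : ℝ) {τ : ℝ} (hN : sqDist x τ ≠ 0) :
    HasDerivAt (potential S C x y) (potentialDeriv S C x y τ) τ := by
  have hid := hasDerivAt_id τ
  have hN' : HasDerivAt (sqDist x) (2 * (τ - x)) τ := by
    have := (((hid.const_mul 2).mul_const x).const_sub 1).add (hid.pow 2)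
    refine (this.congr_deriv ?_).congr_of_eventuallyEq (Eventually.of_forall fun u => ?_)
    · simp; ring
    · simp [sqDist]
  have hm : HasDerivAt (fun u : ℝ => u * (1 - u)) (1 - 2 * τ) τ := by
    refine (hid.mul (hid.const_sub 1)).congr_deriv ?_
    simp; ring
  have hB : HasDerivAt (fun u : ℝ => S ^ 2 * (1 - x) * (1 + u) ^ 2 / 16 + C ^ 2 * (1 + x)
      - C * S * y * (1 + u) / 2) (S ^ 2 * (1 - x) * (1 + τ) / 8 - C * S * y / 2) τ := by
    have h1 := hid.const_add 1
    have := ((((h1.pow 2).const_mul (S ^ 2 * (1 - x))).div_const 16).add_const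
      (C ^ 2 * (1 + x))).sub ((h1.const_mul (C * S * y)).div_const 2)
    refine this.congr_deriv ?_
    simp; ring
  have hnum : HasDerivAt (potentialNum S C x y) (potentialNumDeriv S C x y τ) τ := by
    refine ((hm.pow 2).mul hB).congr_deriv ?_
    simp [potentialNumDeriv]
  have hc : HasDerivAt (fun u : ℝ => u ^ 3 * (1 - u) ^ 4)
      (3 * τ ^ 2 * (1 - τ) ^ 4 - 4 * τ ^ 3 * (1 - τ) ^ 3) τ := by
    refine ((hid.pow 3).mul ((hid.const_sub 1).pow 4)).congr_deriv ?_
    simp; ring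
  refine ((hnum.div hN' hN).add ((hc.const_mul (S ^ 2 * (5 / 8))).div (hN'.pow 2)
    (pow_ne_zero 2 hN))).congr_deriv ?_
  unfold potentialDeriv
  congr 1
  simp only [Pi.pow_apply]
  field_simp
  push_cast
  ring

theorem potential_nonneg (S C : ℝ) {x y τ : ℝ} (hxy : x ^ 2 + y ^ 2 = 1) (h0 : 0 ≤ τ)
    (h1 : τ < 1) : 0 ≤ potential S C x y τ := by
  have hx : x ^ 2 ≤ 1 := by nlinarith
  have hx' := abs_le.mp ((sq_le_one_iff_abs_le_one x).mp hx)
  have hN := sqDist_pos hx'.2 h0 h1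
  have hv : 0 ≤ 1 - τ := by linarith
  have hq := quadForm_nonneg (d := 1 - x) (e := 1 + x) (y := y) (by linarith) (by linarith)
    (by linarith) (S * (1 + τ) / 4) C
  have : potentialNum S C x y τ = (τ * (1 - τ)) ^ 2 *
    ((1 - x) * (S * (1 + τ) / 4) ^ 2 - 2 * y * (S * (1 + τ) / 4) * C + (1 + x) * C ^ 2) := by
    unfold potentialNum; ring
  have h2 : 0 ≤ potentialNum S C x y τ := by rw [this]; positivity
  unfold potential
  positivity

/-- The difference of the two sides is, up to a nonnegative factor, a degenerate quadratic form in
`S` and `C` plus `S ^ 2` times `criticalPoly`. -/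
theorem potentialDeriv_le (S C : ℝ) {x y τ : ℝ} (hxy : x ^ 2 + y ^ 2 = 1) (h0 : 0 ≤ τ)
    (h1 : τ < 1) : potentialDeriv S C x y τ ≤ (1 - τ ^ 2) * kernelGap S C x y τ := by
  have hx : x ^ 2 ≤ 1 := by nlinarith
  have hx' := abs_le.mp ((sq_le_one_iff_abs_le_one x).mp hx)
  have hN := sqDist_pos hx'.2 h0 h1
  have hv : 0 ≤ 1 - τ := by linarith
  -- `G` is read off from the mixed term in `C S`; completing the square with it leaves a remainder
  -- in `S ^ 2` alone.
  set G := (1 - τ) * (5 + 6 * τ - 3 * τ ^ 2) + 2 * (1 - x) * (4 * τ ^ 2 + τ - 1) with hG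
  have hq := quadForm_nonneg (d := 1 - x) (e := 1 + x) (y := y) (by linarith) (by linarith)
    (by linarith) (S * (1 + τ) * G) (8 * C * τ * sqDist x τ)
  have hP := criticalPoly_nonneg (v := 1 - τ) (d := 1 - x) hv (by linarith) (by linarith)
    (by linarith)
  have key : (1 - τ ^ 2) * kernelGap S C x y τ - potentialDeriv S C x y τ =
      τ * (1 - τ) / (32 * sqDist x τ ^ 3 * (1 + τ)) * (S ^ 2 * criticalPoly (1 - τ) (1 - x) +
      ((1 - x) * (S * (1 + τ) * G) ^ 2 - 2 * y * (S * (1 + τ) * G) * (8 * C * τ * sqDist x τ)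
        + (1 + x) * (8 * C * τ * sqDist x τ) ^ 2)) := by
    have hτ : (1 + τ) ≠ 0 := by positivity
    unfold kernelGap potentialDeriv potentialNumDeriv potentialNum
    rw [hG]
    unfold criticalPoly
    field_simp
    unfold sqDist
    ring
  have : 0 ≤ (1 - τ ^ 2) * kernelGap S C x y τ - potentialDeriv S C x y τ := by
    rw [key]; positivity
  linarith

/-- The potential at `r t` is multiplied by `(1 - t²)/(1 - (r t)²)`. The product vanishes at both
ends, and its derivative is at most `r` times the integrand. -/
theorem integral_kernelGap_nonneg (S C : ℝ) {x y r : ℝ} (hxy : x ^ 2 + y ^ 2 = 1) (h0 : 0 ≤ r)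
    (h1 : r < 1) : 0 ≤ ∫ t in (0 : ℝ)..1, (1 - t ^ 2) * kernelGap S C x y (r * t) := by
  rcases h0.eq_or_lt with rfl | h0
  · simp [kernelGap, sqDist]
  have hx : x ^ 2 ≤ 1 := by nlinarith
  have hx' := abs_le.mp ((sq_le_one_iff_abs_le_one x).mp hx)
  have hrt : ∀ t ∈ Set.Icc (0 : ℝ) 1, 0 ≤ r * t ∧ r * t < 1 := fun t ht =>
    ⟨mul_nonneg h0.le ht.1, by nlinarith [ht.1, ht.2]⟩
  have hN : ∀ t ∈ Set.Icc (0 : ℝ) 1, sqDist x (r * t) ≠ 0 := fun t ht =>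
    (sqDist_pos hx'.2 (hrt t ht).1 (hrt t ht).2).ne'
  have hw : ∀ t ∈ Set.Icc (0 : ℝ) 1, 0 < 1 - (r * t) ^ 2 := fun t ht => by
    have := hrt t ht
    nlinarith
  have hgap : ContinuousOn (fun t => (1 - t ^ 2) * kernelGap S C x y (r * t)) (Set.Icc 0 1) := by
    have hs : Continuous fun t => sqDist x (r * t) := by unfold sqDist; fun_prop
    unfold kernelGap
    refine ContinuousOn.mul (by fun_prop) (ContinuousOn.sub (ContinuousOn.add
      (ContinuousOn.mul (by fun_prop) (ContinuousOn.sub ?_ ?_))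
      (ContinuousOn.mul (by fun_prop) (ContinuousOn.sub ?_ ?_)))
      (ContinuousOn.mul (by fun_prop) ?_))
    · exact ContinuousOn.div (by fun_prop) hs.continuousOn hN
    · refine ContinuousOn.div (by fun_prop) (by fun_prop) fun t ht => ?_
      have := (hrt t ht).1
      positivity
    · exact ContinuousOn.div (by fun_prop) (hs.pow 2).continuousOn
        fun t ht => pow_ne_zero 2 (hN t ht)
    · refine ContinuousOn.div (by fun_prop) (by fun_prop) fun t ht => ?_
      have := (hrt t ht).1
      positivity
    · exact ContinuousOn.div (by fun_prop) (hs.pow 2).continuousOn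
        fun t ht => pow_ne_zero 2 (hN t ht)
  -- The weight turns the factor `1 - τ²` of `potentialDeriv_le` into `1 - t²`. It is decreasing, so
  -- the term with its derivative is nonpositive, and it is zero at `t = 1`; at `t = 0` the
  -- potential is zero.
  have hder : ∀ t ∈ Set.Icc (0 : ℝ) 1,
      HasDerivAt (fun t => (1 - t ^ 2) / (1 - (r * t) ^ 2) * potential S C x y (r * t))
        (-(2 * t * (1 - r ^ 2)) / (1 - (r * t) ^ 2) ^ 2 * potential S C x y (r * t)
          + (1 - t ^ 2) / (1 - (r * t) ^ 2) * (potentialDeriv S C x y (r * t) * r)) t := by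
    intro t ht
    have hid := hasDerivAt_id t
    have hrid : HasDerivAt (fun t => r * t) r t := by simpa using hid.const_mul r
    have h2 := ((hid.pow 2).const_sub 1).div ((hrid.pow 2).const_sub 1) (hw t ht).ne'
    have h3 := HasDerivAt.comp t (hasDerivAt_potential S C x y (hN t ht)) hrid
    refine (h2.mul h3).congr_deriv ?_
    simp only [Function.comp, Pi.pow_apply, id]
    congr 2
    push_cast
    ring
  have hle := intervalIntegral.sub_le_integral_of_hasDeriv_right_of_le (zero_le_one' ℝ)
    (fun t ht => (hder t ht).continuousAt.continuousWithinAt)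
    (fun t ht => (hder t ⟨ht.1.le, ht.2.le⟩).hasDerivWithinAt)
    (φ := fun t => r * ((1 - t ^ 2) * kernelGap S C x y (r * t)))
    (ContinuousOn.integrableOn_Icc (continuousOn_const.mul hgap)) (fun t ht => ?_)
  · rw [intervalIntegral.integral_const_mul] at hle
    simp [potential, potentialNum] at hle
    exact nonneg_of_mul_nonneg_right hle h0
  · have ht' : t ∈ Set.Icc (0 : ℝ) 1 := ⟨ht.1.le, ht.2.le⟩
    have hT := potential_nonneg S C hxy (hrt t ht').1 (hrt t ht').2
    have hD := potentialDeriv_le S C hxy (hrt t ht').1 (hrt t ht').2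
    have hwt := hw t ht'
    have h1t : 0 ≤ 1 - t ^ 2 := by nlinarith [ht.1, ht.2]
    have h1r : 0 ≤ 1 - r ^ 2 := by nlinarith
    have e1 : -(2 * t * (1 - r ^ 2)) / (1 - (r * t) ^ 2) ^ 2 * potential S C x y (r * t) ≤ 0 := by
      rw [neg_div, neg_mul, neg_nonpos]
      have := ht.1
      positivity
    have e2 : (1 - t ^ 2) / (1 - (r * t) ^ 2) * (potentialDeriv S C x y (r * t) * r) ≤
        (1 - t ^ 2) / (1 - (r * t) ^ 2) *
          ((1 - (r * t) ^ 2) * kernelGap S C x y (r * t) * r) :=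
      mul_le_mul_of_nonneg_left (mul_le_mul_of_nonneg_right hD h0.le) (by positivity)
    have e3 : (1 - t ^ 2) / (1 - (r * t) ^ 2) *
          ((1 - (r * t) ^ 2) * kernelGap S C x y (r * t) * r) =
        r * ((1 - t ^ 2) * kernelGap S C x y (r * t)) := by
      rw [div_mul_eq_mul_div, div_eq_iff hwt.ne']
      ring
    linarith

/-! ### Extremal multipliers. -/

/-- Since `∫ s^(κ-1+m) ds = 1/(m + κ)`, averaging a series along the segment from `0` divides its
coefficients by `m + κ`. The multipliers, the functions `g` and `q`, and the Bernardi transform are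
all treated in this way. -/
theorem hasSum_integral_rpow_smul {E : Type*} [NormedAddCommGroup E] [NormedSpace ℝ E]
    [CompleteSpace E] {a : ℕ → E} (ha : Summable fun m => ‖a m‖) {κ : ℝ} (hκ : 0 < κ) :
    HasSum (fun m : ℕ => (1 / (m + κ)) • a m)
      (∫ s in (0 : ℝ)..1, s ^ (κ - 1) • ∑' m : ℕ, s ^ m • a m) := by
  have hpow : IntervalIntegrable (fun x : ℝ => x ^ (κ - 1)) volume 0 1 :=
    intervalIntegral.intervalIntegrable_rpow' (by linarith)
  have hmeas : Measurable (fun x : ℝ => x ^ (κ - 1)) := by fun_prop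
  have hbd : ∀ (m : ℕ), ∀ s ∈ Set.uIoc (0 : ℝ) 1, ‖s ^ m • a m‖ ≤ ‖a m‖ := fun m s hs => by
    rw [Set.uIoc_of_le zero_le_one] at hs
    rw [norm_smul, Real.norm_of_nonneg (pow_nonneg hs.1.le m)]
    exact mul_le_of_le_one_left (norm_nonneg _) (pow_le_one₀ hs.1.le hs.2)
  have key := intervalIntegral.hasSum_integral_of_dominated_convergence (μ := volume)
    (a := 0) (b := 1) (F := fun (m : ℕ) s => s ^ (κ - 1) • s ^ m • a m)
    (f := fun s => s ^ (κ - 1) • ∑' m : ℕ, s ^ m • a m)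
    (fun m s => s ^ (κ - 1) * ‖a m‖) (fun m => ?_) (fun m => ?_) ?_ ?_ ?_
  · convert key using 2 with m
    have h1 : ∫ s in (0 : ℝ)..1, s ^ (κ - 1) • s ^ m • a m
        = ∫ s in (0 : ℝ)..1, s ^ ((m + κ) - 1) • a m := by
      refine intervalIntegral.integral_congr_ae (Eventually.of_forall fun s hs => ?_)
      rw [Set.uIoc_of_le zero_le_one] at hs
      rw [smul_smul, ← Real.rpow_natCast s m, ← Real.rpow_add hs.1]
      congr 2; ring
    rw [h1, intervalIntegral.integral_smul_const, powerAverage_const (by positivity)]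
  · exact (hmeas.aestronglyMeasurable).smul
      ((by fun_prop : Continuous fun s : ℝ => s ^ m • a m).aestronglyMeasurable)
  · refine Eventually.of_forall fun s hs => ?_
    have := hbd m s hs
    rw [Set.uIoc_of_le zero_le_one] at hs
    rw [norm_smul, Real.norm_of_nonneg (Real.rpow_nonneg hs.1.le _)]
    exact mul_le_mul_of_nonneg_left this (Real.rpow_nonneg hs.1.le _)
  · exact Eventually.of_forall fun s _ => ha.mul_left _
  · simp only [tsum_mul_left]
    exact hpow.mul_const _
  · refine Eventually.of_forall fun s hs => ?_
    exact (ha.of_nonneg_of_le (fun _ => norm_nonneg _)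
      fun m => hbd m s hs).of_norm.hasSum.const_smul _

/-- Terms of the difference between the kernel with parameter `u` at `z` and the extremal kernel
at `-‖z‖`. -/
noncomputable def gapTerm (u z : ℂ) (m : ℕ) : ℝ :=
  ((1 + m * (u.re * u)) * z ^ m).re - (1 + m) * (-‖z‖) ^ m

theorem gapTerm_real_mul (u z : ℂ) (m : ℕ) {s : ℝ} (hs : 0 ≤ s) :
    gapTerm u (s * z) m = s ^ m * gapTerm u z m := by
  have h : (1 + m * (u.re * u)) * ((s : ℂ) * z) ^ m
      = ((s ^ m : ℝ) : ℂ) * ((1 + m * (u.re * u)) * z ^ m) := by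
    push_cast; ring
  unfold gapTerm
  rw [h, Complex.re_ofReal_mul, norm_mul, Complex.norm_real, Real.norm_of_nonneg hs,
    ← mul_neg, mul_pow]
  ring

/-- The series sums to `Re (1/(1-w) + Re(u) u w/(1-w)²) - 1/(1+τ)²`. Since `|u| = 1`, this is a
quadratic form in `S = Im u` and `C = Re u`. -/
theorem hasSum_gapTerm {u : ℂ} (hu : u.re ^ 2 + u.im ^ 2 = 1) {x y τ : ℝ}
    (hxy : x ^ 2 + y ^ 2 = 1) (h0 : 0 ≤ τ) (h1 : τ < 1) :
    HasSum (gapTerm u (τ * ⟨x, y⟩)) (kernelGap u.im u.re x y τ) := by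
  have hn : ‖(⟨x, y⟩ : ℂ)‖ = 1 := by
    rw [Complex.norm_def, Complex.normSq_mk, Real.sqrt_eq_one]
    linarith
  have hx' := abs_le.mp ((sq_le_one_iff_abs_le_one x).mp (by nlinarith))
  have hN := sqDist_pos hx'.2 h0 h1
  set w : ℂ := τ * ⟨x, y⟩ with hw
  have hwn : ‖w‖ = τ := by rw [hw, norm_mul, hn, Complex.norm_real, Real.norm_of_nonneg h0, mul_one]
  have hw1 : ‖w‖ < 1 := by rw [hwn]; exact h1
  have hm1 : ‖(-τ)‖ < 1 := by rw [norm_neg, Real.norm_of_nonneg h0]; exact h1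
  have s1 := (hasSum_geometric_of_norm_lt_one hw1).add
    ((hasSum_coe_mul_geometric_of_norm_lt_one hw1).mul_left (u.re * u))
  have s2 := (hasSum_geometric_of_norm_lt_one hm1).add (hasSum_coe_mul_geometric_of_norm_lt_one hm1)
  have s3 := (Complex.hasSum_re s1).sub s2
  have hinv : (1 - w)⁻¹ = (⟨(1 - τ * x) / sqDist x τ, τ * y / sqDist x τ⟩ : ℂ) := by
    refine inv_eq_of_mul_eq_one_right ?_
    apply Complex.ext
    · simp [hw]
      field_simp
      unfold sqDist
      linear_combination τ ^ 2 * hxy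
    · simp [hw]
      field_simp
      ring
  have hτ : (1 + τ) ≠ 0 := by positivity
  have hNne := hN.ne'
  have hf : gapTerm u w = fun m : ℕ =>
      (w ^ m + u.re * u * (m * w ^ m)).re - ((-τ) ^ m + m * (-τ) ^ m) := by
    funext m
    simp only [gapTerm, hwn]
    congr 2
    · ring
    · ring
  have hv : kernelGap u.im u.re x y τ = ((1 - w)⁻¹ + u.re * u * (w / (1 - w) ^ 2)).re
      - ((1 - -τ)⁻¹ + -τ / (1 - -τ) ^ 2) := by
    rw [div_eq_mul_inv w, ← inv_pow, hinv, sub_neg_eq_add]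
    have hq : w * (⟨(1 - τ * x) / sqDist x τ, τ * y / sqDist x τ⟩ : ℂ) ^ 2 =
        ⟨(τ * x - 2 * τ ^ 2 + τ ^ 3 * x) / sqDist x τ ^ 2, (τ - τ ^ 3) * y / sqDist x τ ^ 2⟩ := by
      apply Complex.ext
      · simp [hw, pow_two]
        field_simp
        linear_combination (-2 * τ ^ 2 + τ ^ 3 * x) * hxy
      · simp [hw, pow_two]
        field_simp
        linear_combination (-τ ^ 3 * y) * hxy
    rw [hq]
    simp only [Complex.add_re, Complex.mul_re, Complex.mul_im, Complex.ofReal_re,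
      Complex.ofReal_im, zero_mul, sub_zero, add_zero]
    have hS : u.im ^ 2 = 1 - u.re ^ 2 := by linarith
    unfold kernelGap
    rw [hS]
    field_simp
    unfold sqDist
    ring
  rw [hf, hv]
  exact s3

theorem norm_one_add_mul_le {u : ℂ} (hu : u.re ^ 2 + u.im ^ 2 = 1) (m : ℕ) :
    ‖(1 + m * (u.re * u) : ℂ)‖ ≤ 1 + m := by
  have h1 : ‖u‖ = 1 := by
    rw [Complex.norm_def, Complex.normSq_apply, Real.sqrt_eq_one]; nlinarith
  have h2 : |u.re| ≤ 1 := h1 ▸ Complex.abs_re_le_norm u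
  refine (norm_add_le _ _).trans ?_
  rw [norm_one, norm_mul, norm_mul, h1, mul_one, Complex.norm_natCast, Complex.norm_real,
    Real.norm_eq_abs]
  have : (m : ℝ) * |u.re| ≤ m * 1 := mul_le_mul_of_nonneg_left h2 (Nat.cast_nonneg m)
  linarith

theorem summable_one_add_mul_pow {r : ℝ} (h0 : 0 ≤ r) (h1 : r < 1) :
    Summable fun m : ℕ => (1 + m) * r ^ m := by
  have hr : ‖r‖ < 1 := by rwa [Real.norm_of_nonneg h0]
  refine ((summable_geometric_of_norm_lt_one hr).add
    (hasSum_coe_mul_geometric_of_norm_lt_one hr).summable).congr fun m => ?_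
  ring

theorem abs_gapTerm_le {u z : ℂ} (hu : u.re ^ 2 + u.im ^ 2 = 1) (m : ℕ) :
    |gapTerm u z m| ≤ 2 * ((1 + m) * ‖z‖ ^ m) := by
  have h1 : |((1 + m * (u.re * u)) * z ^ m).re| ≤ (1 + m) * ‖z‖ ^ m := by
    refine (Complex.abs_re_le_norm _).trans ?_
    rw [norm_mul, norm_pow]
    exact mul_le_mul_of_nonneg_right (norm_one_add_mul_le hu m) (by positivity)
  have h2 : |(1 + m) * (-‖z‖) ^ m| = (1 + m) * ‖z‖ ^ m := by
    rw [abs_mul, abs_pow, abs_neg, abs_norm, abs_of_nonneg (by positivity)]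
  have h3 := abs_sub (((1 + m * (u.re * u)) * z ^ m).re) ((1 + m) * (-‖z‖) ^ m)
  unfold gapTerm
  linarith

theorem summable_mul_gapTerm {c : ℕ → ℝ} {B : ℝ} (hc : ∀ m, |c m| ≤ B) {u z : ℂ}
    (hu : u.re ^ 2 + u.im ^ 2 = 1) (hz : ‖z‖ < 1) : Summable fun m => ‖c m * gapTerm u z m‖ := by
  refine (((summable_one_add_mul_pow (norm_nonneg z) hz).mul_left 2).mul_left B).of_nonneg_of_le
    (fun _ => norm_nonneg _) fun m => ?_
  rw [norm_mul, Real.norm_eq_abs, Real.norm_eq_abs]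
  exact mul_le_mul (hc m) (abs_gapTerm_le hu m) (abs_nonneg _) ((abs_nonneg _).trans (hc m))

/-- Bounded multipliers for which the extremal kernel is minimal at the point `-‖z‖`. -/
structure ExtremalMultiplier (c : ℕ → ℝ) : Prop where
  bounded : ∃ B, ∀ m, |c m| ≤ B
  tsum_nonneg : ∀ u z : ℂ, u.re ^ 2 + u.im ^ 2 = 1 → ‖z‖ < 1 → 0 ≤ ∑' m, c m * gapTerm u z m

namespace ExtremalMultiplier

theorem summable {c : ℕ → ℝ} (hc : ExtremalMultiplier c) {u z : ℂ}
    (hu : u.re ^ 2 + u.im ^ 2 = 1) (hz : ‖z‖ < 1) : Summable fun m => ‖c m * gapTerm u z m‖ :=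
  let ⟨_, hB⟩ := hc.bounded
  summable_mul_gapTerm hB hu hz

theorem linearCombination {a b : ℕ → ℝ} (ha : ExtremalMultiplier a) (hb : ExtremalMultiplier b)
    {p q : ℝ} (hp : 0 ≤ p) (hq : 0 ≤ q) : ExtremalMultiplier fun m => p * a m + q * b m where
  bounded := by
    obtain ⟨A, hA⟩ := ha.bounded
    obtain ⟨B, hB⟩ := hb.bounded
    refine ⟨p * A + q * B, fun m => (abs_add_le _ _).trans ?_⟩
    rw [abs_mul, abs_mul, abs_of_nonneg hp, abs_of_nonneg hq]
    exact add_le_add (mul_le_mul_of_nonneg_left (hA m) hp) (mul_le_mul_of_nonneg_left (hB m) hq)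
  tsum_nonneg u z hu hz := by
    have h1 := (ha.summable hu hz).of_norm
    have h2 := (hb.summable hu hz).of_norm
    have h := (h1.hasSum.mul_left p).add (h2.hasSum.mul_left q)
    have e : (fun m => p * (a m * gapTerm u z m) + q * (b m * gapTerm u z m)) =
        fun m => (p * a m + q * b m) * gapTerm u z m := by
      funext m; ring
    rw [e] at h
    rw [h.tsum_eq]
    exact add_nonneg (mul_nonneg hp (ha.tsum_nonneg u z hu hz))
      (mul_nonneg hq (hb.tsum_nonneg u z hu hz))

/-- The new sum is an average, with positive weight, of the old sums at the points `s z`; the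
extremal point `-‖z‖` scales along with `z`. -/
theorem div_add {c : ℕ → ℝ} (hc : ExtremalMultiplier c) {κ : ℝ} (hκ : 0 < κ) :
    ExtremalMultiplier fun m => c m / (m + κ) where
  bounded := by
    obtain ⟨B, hB⟩ := hc.bounded
    refine ⟨B / κ, fun m => ?_⟩
    rw [abs_div, abs_of_pos (by positivity : 0 < m + κ)]
    exact div_le_div₀ ((abs_nonneg _).trans (hB 0)) (hB m) hκ
      (le_add_of_nonneg_left (Nat.cast_nonneg m))
  tsum_nonneg u z hu hz := by
    have h := hasSum_integral_rpow_smul (hc.summable hu hz) hκ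
    have e : (fun m : ℕ => (1 / (m + κ)) • (c m * gapTerm u z m)) =
        fun m => c m / (m + κ) * gapTerm u z m := by
      funext m; rw [smul_eq_mul]; ring
    rw [e] at h
    rw [h.tsum_eq]
    refine intervalIntegral.integral_nonneg zero_le_one fun s hs => ?_
    refine mul_nonneg (Real.rpow_nonneg hs.1 _) ?_
    have hsz : ‖(s : ℂ) * z‖ < 1 := by
      rw [norm_mul, Complex.norm_real, Real.norm_of_nonneg hs.1]
      exact (mul_le_of_le_one_left (norm_nonneg z) hs.2).trans_lt hz
    have h2 := hc.tsum_nonneg u (s * z) hu hsz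
    refine h2.trans_eq (tsum_congr fun m => ?_)
    rw [gapTerm_real_mul u z m hs.1, smul_eq_mul]
    ring

/-- The multiplier of `∫ (1 - t²) / (1 - t z) dt`. -/
theorem base : ExtremalMultiplier fun m => 1 / ((m : ℝ) + 1) - 1 / (m + 3) where
  bounded := by
    refine ⟨1, fun m => ?_⟩
    have h0 : (0 : ℝ) ≤ m := Nat.cast_nonneg m
    have h1 : 1 / ((m : ℝ) + 3) ≤ 1 / (m + 1) :=
      one_div_le_one_div_of_le (by positivity) (by linarith)
    have h2 : 1 / ((m : ℝ) + 1) ≤ 1 := by rw [div_le_one (by positivity)]; linarith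
    have h3 : 0 ≤ 1 / ((m : ℝ) + 3) := by positivity
    rw [abs_le]
    constructor <;> linarith
  tsum_nonneg u z hu hz := by
    have hs : Summable fun m => ‖gapTerm u z m‖ := by
      simpa using summable_mul_gapTerm (c := fun _ => 1) (B := 1) (by simp) hu hz
    have h := (hasSum_integral_rpow_smul hs one_pos).sub
      (hasSum_integral_rpow_smul hs (by norm_num : (0 : ℝ) < 3))
    simp only [smul_eq_mul, ← sub_mul] at h
    rw [h.tsum_eq]
    -- Polar form of `z`, with direction `x + i y`; at `z = 0` the argument still supplies a unit
    -- vector.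
    obtain ⟨x, y, hxy, hzxy⟩ : ∃ x y : ℝ, x ^ 2 + y ^ 2 = 1 ∧ z = ‖z‖ * (⟨x, y⟩ : ℂ) := by
      refine ⟨Real.cos z.arg, Real.sin z.arg, by rw [add_comm, Real.sin_sq_add_cos_sq], ?_⟩
      conv_lhs => rw [← Complex.norm_mul_exp_arg_mul_I z]
      congr 1
      apply Complex.ext
      · simp [Complex.exp_ofReal_mul_I_re]
      · simp [Complex.exp_ofReal_mul_I_im]
    have hker : ∀ s ∈ Set.Icc (0 : ℝ) 1,
        ∑' m : ℕ, s ^ m * gapTerm u z m = kernelGap u.im u.re x y (‖z‖ * s) := by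
      intro s hs
      have h1 : ‖z‖ * s < 1 := (mul_le_of_le_one_right (norm_nonneg z) hs.2).trans_lt hz
      have h2 := hasSum_gapTerm hu hxy (mul_nonneg (norm_nonneg z) hs.1) h1
      have h3 : ((‖z‖ * s : ℝ) : ℂ) * ⟨x, y⟩ = s * z := by
        conv_rhs => rw [hzxy]
        push_cast; ring
      rw [h3] at h2
      rw [← h2.tsum_eq]
      exact tsum_congr fun m => (gapTerm_real_mul u z m hs.1).symm
    have hI := integral_kernelGap_nonneg u.im u.re hxy (norm_nonneg z) hz
    have hcont : ContinuousOn (fun s : ℝ => ∑' m : ℕ, s ^ m * gapTerm u z m) (Set.Icc 0 1) := by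
      refine continuousOn_tsum (fun m => by fun_prop) hs fun m s hs => ?_
      rw [norm_mul, norm_pow, Real.norm_of_nonneg hs.1]
      exact mul_le_of_le_one_left (norm_nonneg _) (pow_le_one₀ hs.1 hs.2)
    rw [← Set.uIcc_of_le zero_le_one] at hcont
    have i1 : IntervalIntegrable (fun s : ℝ => s ^ ((1 : ℝ) - 1) * ∑' m : ℕ, s ^ m * gapTerm u z m)
        volume 0 1 :=
      (intervalIntegral.intervalIntegrable_rpow' (by norm_num)).mul_continuousOn hcont
    have i3 : IntervalIntegrable (fun s : ℝ => s ^ ((3 : ℝ) - 1) * ∑' m : ℕ, s ^ m * gapTerm u z m)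
        volume 0 1 :=
      (intervalIntegral.intervalIntegrable_rpow' (by norm_num)).mul_continuousOn hcont
    rw [← intervalIntegral.integral_sub i1 i3]
    refine hI.trans_eq (intervalIntegral.integral_congr fun s hs => ?_)
    rw [Set.uIcc_of_le zero_le_one] at hs
    rw [hker s hs, sub_self, Real.rpow_zero, show (3 : ℝ) - 1 = ((2 : ℕ) : ℝ) by norm_num,
      Real.rpow_natCast]
    ring

/-- The multiplier `(1 + ξ m) C a b / ((m + C) (m + a) (m + b))`. -/
theorem product {ξ a b C : ℝ} (hξ0 : 0 ≤ ξ) (hξ1 : ξ ≤ 1) (ha0 : 0 < a) (ha1 : a ≤ 1)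
    (hb0 : 0 < b) (hb1 : b ≤ 1) (hC0 : 0 < C) (hC3 : C ≤ 3) :
    ExtremalMultiplier fun m => (1 + ξ * m) * (C * a * b) / ((m + C) * (m + a) * (m + b)) := by
  -- `1 + (3 - C)/(m + C) = (m + 3)/(m + C)`: the factor `m + 3` of the base denominator is
  -- exchanged for `m + C`. This is where `C ≤ 3` enters; in the same way `a ≤ 1` lets `m + 1`
  -- become `m + a`.
  have h1 := base.linearCombination (base.div_add hC0) zero_le_one (sub_nonneg.mpr hC3)
  have h2 := h1.linearCombination (h1.div_add ha0) zero_le_one (sub_nonneg.mpr ha1)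
  have hξb : 0 ≤ 1 - ξ * b := by nlinarith
  -- `ξ + (1 - ξ b)/(m + b) = (1 + ξ m)/(m + b)`.
  have h3 := h2.linearCombination (h2.div_add hb0) hξ0 hξb
  -- The base multiplier is `2/((m+1)(m+3))`, whence the halving in the normalization.
  have h4 := h3.linearCombination h3 (by positivity : 0 ≤ C * a * b / 2) le_rfl
  convert h4 using 2 with m
  have hm : (0 : ℝ) ≤ m := Nat.cast_nonneg m
  field_simp
  ring

end ExtremalMultiplier

/-! ### The extremal value as an iterated average. -/

/-- The average `∫₀¹ x ^ (κ - 1) φ (t x) dx`. -/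
noncomputable def powerAverage (κ : ℝ) (φ : ℝ → ℝ) (t : ℝ) : ℝ :=
  ∫ x in (0 : ℝ)..1, x ^ (κ - 1) * φ (t * x)

theorem intervalIntegrable_powerAverage {κ : ℝ} (hκ : 0 < κ) {φ : ℝ → ℝ}
    (hφ : ContinuousOn φ (Set.Ici 0)) {t : ℝ} (ht : 0 ≤ t) :
    IntervalIntegrable (fun x : ℝ => x ^ (κ - 1) * φ (t * x)) volume 0 1 := by
  refine (intervalIntegral.intervalIntegrable_rpow' (by linarith)).mul_continuousOn
    (hφ.comp (by fun_prop) fun x hx => ?_)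
  rw [Set.uIcc_of_le zero_le_one] at hx
  exact mul_nonneg ht hx.1

theorem powerAverage_linear {κ : ℝ} (hκ : 0 < κ) {φ ψ : ℝ → ℝ}
    (hφ : ContinuousOn φ (Set.Ici 0)) (hψ : ContinuousOn ψ (Set.Ici 0)) (p q : ℝ) {t : ℝ}
    (ht : 0 ≤ t) : powerAverage κ (fun u => p * φ u + q * ψ u) t
      = p * powerAverage κ φ t + q * powerAverage κ ψ t := by
  unfold powerAverage
  rw [← intervalIntegral.integral_const_mul, ← intervalIntegral.integral_const_mul,
    ← intervalIntegral.integral_add ((intervalIntegrable_powerAverage hκ hφ ht).const_mul p)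
      ((intervalIntegrable_powerAverage hκ hψ ht).const_mul q)]
  refine intervalIntegral.integral_congr fun x _ => ?_
  ring

theorem powerAverage_congr {κ : ℝ} {φ ψ : ℝ → ℝ} (h : Set.EqOn φ ψ (Set.Ici 0)) {t : ℝ}
    (ht : 0 ≤ t) : powerAverage κ φ t = powerAverage κ ψ t := by
  refine intervalIntegral.integral_congr fun x hx => ?_
  rw [Set.uIcc_of_le zero_le_one] at hx
  simp only [h (Set.mem_Ici.mpr (mul_nonneg ht hx.1))]

theorem strictAntiOn_powerAverage {κ : ℝ} (hκ : 0 < κ) {φ : ℝ → ℝ}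
    (hφ : ContinuousOn φ (Set.Ici 0)) (hanti : StrictAntiOn φ (Set.Icc 0 1)) :
    StrictAntiOn (powerAverage κ φ) (Set.Icc 0 1) := by
  intro s hs t ht hst
  rw [← sub_pos]
  have is := intervalIntegrable_powerAverage hκ hφ hs.1
  have it := intervalIntegrable_powerAverage hκ hφ ht.1
  unfold powerAverage
  rw [← intervalIntegral.integral_sub is it]
  refine intervalIntegral.intervalIntegral_pos_of_pos_on (is.sub it) (fun x hx => ?_) one_pos
  rw [← mul_sub]
  refine mul_pos (Real.rpow_pos_of_pos hx.1 _) (sub_pos.mpr (hanti ?_ ?_ ?_))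
  · exact ⟨mul_nonneg hs.1 hx.1.le, mul_le_one₀ hs.2 hx.1.le hx.2.le⟩
  · exact ⟨mul_nonneg ht.1 hx.1.le, mul_le_one₀ ht.2 hx.1.le hx.2.le⟩
  · exact mul_lt_mul_of_pos_right hst hx.1

theorem hasSum_powerAverage {κ : ℝ} (hκ : 0 < κ) {φ : ℝ → ℝ} {c : ℕ → ℝ}
    (h : ∀ t ∈ Set.Ico (0 : ℝ) 1, HasSum (fun m => c m * (-t) ^ m) (φ t)) {t : ℝ}
    (ht : t ∈ Set.Ico (0 : ℝ) 1) :
    HasSum (fun m => c m / (m + κ) * (-t) ^ m) (powerAverage κ φ t) := by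
  have key := hasSum_integral_rpow_smul (h t ht).summable.norm hκ
  have e : (fun m : ℕ => (1 / (m + κ)) • (c m * (-t) ^ m)) =
      fun m => c m / (m + κ) * (-t) ^ m := by
    funext m; rw [smul_eq_mul]; ring
  rw [e] at key
  have e2 : powerAverage κ φ t =
      ∫ s in (0 : ℝ)..1, s ^ (κ - 1) • ∑' m : ℕ, s ^ m • (c m * (-t) ^ m) := by
    refine intervalIntegral.integral_congr fun s hs => ?_
    rw [Set.uIcc_of_le zero_le_one] at hs
    have h2 := h (t * s) ⟨mul_nonneg ht.1 hs.1,
      (mul_le_of_le_one_right ht.1 hs.2).trans_lt ht.2⟩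
    simp only [smul_eq_mul]
    rw [← h2.tsum_eq]
    congr 1
    refine tsum_congr fun m => ?_
    rw [← neg_mul, mul_pow]
    ring
  rw [e2]
  exact key

/-- The kernel `(1 - ξ) / (1 + u)² + ξ (1 - u) / (1 + u)³`. -/
noncomputable def pascuKernel (ξ u : ℝ) : ℝ :=
  (1 - ξ) * (1 / (1 + u) ^ 2) + ξ * ((1 - u) / (1 + u) ^ 3)

theorem continuousOn_pascuKernel_left :
    ContinuousOn (fun u : ℝ => 1 / (1 + u) ^ 2) (Set.Ici 0) := by
  refine ContinuousOn.div (by fun_prop) (by fun_prop) fun u hu => ?_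
  have : (0 : ℝ) ≤ u := hu
  positivity

theorem continuousOn_pascuKernel_right :
    ContinuousOn (fun u : ℝ => (1 - u) / (1 + u) ^ 3) (Set.Ici 0) := by
  refine ContinuousOn.div (by fun_prop) (by fun_prop) fun u hu => ?_
  have : (0 : ℝ) ≤ u := hu
  positivity

theorem continuousOn_pascuKernel (ξ : ℝ) : ContinuousOn (pascuKernel ξ) (Set.Ici 0) :=
  (continuousOn_const.mul continuousOn_pascuKernel_left).add
    (continuousOn_const.mul continuousOn_pascuKernel_right)

theorem strictAntiOn_pascuKernel {ξ : ℝ} (h0 : 0 ≤ ξ) (h1 : ξ ≤ 1) :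
    StrictAntiOn (pascuKernel ξ) (Set.Icc 0 1) := by
  intro s hs t ht hst
  have hs1 : 0 < 1 + s := by linarith [hs.1]
  have ht1 : 0 < 1 + t := by linarith [ht.1]
  have a2 : 1 / (1 + t) ^ 2 < 1 / (1 + s) ^ 2 :=
    one_div_lt_one_div_of_lt (by positivity) (pow_lt_pow_left₀ (by linarith) hs1.le (by norm_num))
  have a3 : (1 - t) / (1 + t) ^ 3 < (1 - s) / (1 + s) ^ 3 :=
    div_lt_div₀ (by linarith) (pow_le_pow_left₀ hs1.le (by linarith) 3) (by linarith [hs.2, ht.2])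
      (by positivity)
  unfold pascuKernel
  -- For `ξ = 0` strictness comes from the first summand, otherwise from the second.
  rcases h0.eq_or_lt with rfl | h0
  · linarith
  · have e1 := mul_le_mul_of_nonneg_left a2.le (sub_nonneg.mpr h1)
    have e2 := mul_lt_mul_of_pos_left a3 h0
    linarith

theorem hasSum_pascuKernel (ξ : ℝ) {t : ℝ} (ht : t ∈ Set.Ico (0 : ℝ) 1) :
    HasSum (fun m : ℕ => (m + 1) * (1 + ξ * m) * (-t) ^ m) (pascuKernel ξ t) := by
  have hn : ‖-t‖ < 1 := by rw [norm_neg, Real.norm_of_nonneg ht.1]; exact ht.2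
  have h1 := hasSum_choose_mul_geometric_of_norm_lt_one 1 hn
  have h2 := hasSum_choose_mul_geometric_of_norm_lt_one 2 hn
  -- Uses `(1 - u)/(1 + u)³ = 2/(1 + u)³ - 1/(1 + u)²`.
  have h := (h1.mul_left (1 - 2 * ξ)).add (h2.mul_left (2 * ξ))
  have hc : ∀ m : ℕ, (((m + 2).choose 2 : ℕ) : ℝ) = (m + 2) * (m + 1) / 2 := fun m => by
    rw [Nat.cast_choose_two]; push_cast; ring
  have e1 : (fun m : ℕ => (1 - 2 * ξ) * (((m + 1).choose 1 : ℕ) * (-t) ^ m)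
      + 2 * ξ * (((m + 2).choose 2 : ℕ) * (-t) ^ m))
      = fun m : ℕ => (m + 1) * (1 + ξ * m) * (-t) ^ m := by
    funext m
    rw [hc, Nat.choose_one_right]
    push_cast
    ring
  have e2 : (1 - 2 * ξ) * (1 / (1 - -t) ^ (1 + 1)) + 2 * ξ * (1 / (1 - -t) ^ (2 + 1))
      = pascuKernel ξ t := by
    have : 1 + t ≠ 0 := by linarith [ht.1]
    unfold pascuKernel
    rw [sub_neg_eq_add]
    field_simp
    ring
  rw [e1, e2] at h
  exact h

/-- The double average of the kernel; a combination of `gFun` and `qFun`. -/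
noncomputable def pascuAverage (μ ν ξ t : ℝ) : ℝ :=
  1 / (μ * ν) * powerAverage (1 / ν) (powerAverage (1 / μ) (pascuKernel ξ)) t

theorem pascuAverage_eq {μ ν ξ t : ℝ} (hμ : 0 < μ) (hν : 0 < ν) (ht : 0 ≤ t) :
    pascuAverage μ ν ξ t = (1 - ξ) * ((gFun μ ν t + 1) / 2) + ξ * qFun μ ν t := by
  have hμ' := one_div_pos.mpr hμ
  have hν' := one_div_pos.mpr hν
  have h1 : Set.EqOn (powerAverage (1 / μ) (pascuKernel ξ))
      (fun t => (1 - ξ) * powerAverage (1 / μ) (fun u => 1 / (1 + u) ^ 2) t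
        + ξ * powerAverage (1 / μ) (fun u => (1 - u) / (1 + u) ^ 3) t) (Set.Ici 0) :=
    fun t ht => powerAverage_linear hμ' continuousOn_pascuKernel_left
      continuousOn_pascuKernel_right _ _ ht
  unfold pascuAverage
  have c1 : ContinuousOn (powerAverage (1 / μ) (fun u => 1 / (1 + u) ^ 2)) (Set.Ici 0) :=
    continuousOn_powerAverage hμ' continuousOn_pascuKernel_left
  have c2 : ContinuousOn (powerAverage (1 / μ) (fun u => (1 - u) / (1 + u) ^ 3)) (Set.Ici 0) :=
    continuousOn_powerAverage hμ' continuousOn_pascuKernel_right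
  rw [powerAverage_congr h1 ht, powerAverage_linear hν' c1 c2 _ _ ht]
  have e1 : gFun μ ν t = 2 / (μ * ν) * powerAverage (1 / ν)
      (powerAverage (1 / μ) (fun u => 1 / (1 + u) ^ 2)) t - 1 := by
    simp only [gFun, powerAverage, mul_one_div, mul_comm (t * _)]
  have e2 : qFun μ ν t = 1 / (μ * ν) * powerAverage (1 / ν)
      (powerAverage (1 / μ) (fun u => (1 - u) / (1 + u) ^ 3)) t := by
    simp only [qFun, powerAverage, mul_comm]
  rw [e1, e2]
  ring

theorem continuousOn_pascuAverage {μ ν : ℝ} (ξ : ℝ) (hμ : 0 < μ) (hν : 0 < ν) :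
    ContinuousOn (pascuAverage μ ν ξ) (Set.Ici 0) :=
  continuousOn_const.mul (continuousOn_powerAverage (one_div_pos.mpr hν)
    (continuousOn_powerAverage (one_div_pos.mpr hμ) (continuousOn_pascuKernel ξ)))

theorem strictAntiOn_pascuAverage {μ ν ξ : ℝ} (hμ : 0 < μ) (hν : 0 < ν) (h0 : 0 ≤ ξ)
    (h1 : ξ ≤ 1) : StrictAntiOn (pascuAverage μ ν ξ) (Set.Icc 0 1) := by
  have h := strictAntiOn_powerAverage (one_div_pos.mpr hν)
    (continuousOn_powerAverage (one_div_pos.mpr hμ) (continuousOn_pascuKernel ξ))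
    (strictAntiOn_powerAverage (one_div_pos.mpr hμ) (continuousOn_pascuKernel ξ)
      (strictAntiOn_pascuKernel h0 h1))
  exact fun s hs t ht hst =>
    mul_lt_mul_of_pos_left (h hs ht hst) (one_div_pos.mpr (mul_pos hμ hν))

/-- Taylor coefficients of the extremal function. -/
noncomputable def pascuCoeff (μ ν ξ c : ℝ) (m : ℕ) : ℝ :=
  (1 + ξ * m) * (1 + c) / ((1 + c + m) * ((1 + μ * m) * (1 + ν * m)))

/-- This is the kernel at the extremal configuration `u = 1`, `z = -r`: three successive averages
divide the coefficients of `pascuKernel` by `m + 1/μ`, `m + 1/ν` and `m + 1 + c`. -/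
theorem hasSum_pascuCoeff {μ ν ξ c r : ℝ} (hμ : 0 < μ) (hν : 0 < ν) (hc : -1 < c)
    (hr : r ∈ Set.Ico (0 : ℝ) 1) :
    HasSum (fun m : ℕ => pascuCoeff μ ν ξ c m * ((1 + m) * (-r) ^ m))
      ((1 + c) * powerAverage (1 + c) (pascuAverage μ ν ξ) r) := by
  have h1 := fun t ht => hasSum_powerAverage (one_div_pos.mpr hμ)
    (fun t ht => hasSum_pascuKernel ξ ht) (t := t) ht
  have h2 := fun t ht => (hasSum_powerAverage (one_div_pos.mpr hν) h1 (t := t) ht).mul_left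
    (1 / (μ * ν))
  simp only [← mul_assoc] at h2
  have h3 := (hasSum_powerAverage (by linarith : 0 < 1 + c) h2 hr).mul_left (1 + c)
  refine Eq.mp (congrArg (HasSum · _) (funext fun m => ?_)) h3
  have hm : (0 : ℝ) ≤ m := Nat.cast_nonneg m
  have hcm : (0 : ℝ) < 1 + c + m := by linarith
  have hcm' : (0 : ℝ) < m + (1 + c) := by linarith
  unfold pascuCoeff
  field_simp
  ring

theorem pascuCoeff_extremal {μ ν ξ c : ℝ} (hξ0 : 0 ≤ ξ) (hξ1 : ξ ≤ 1) (hμ : 1 ≤ μ) (hν : 1 ≤ ν)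
    (hc : -1 < c) (hc2 : c ≤ 2) : ExtremalMultiplier (pascuCoeff μ ν ξ c) := by
  have hμ0 : 0 < μ := by linarith
  have hν0 : 0 < ν := by linarith
  have h := ExtremalMultiplier.product hξ0 hξ1 (one_div_pos.mpr hμ0)
    ((div_le_one hμ0).mpr hμ) (one_div_pos.mpr hν0) ((div_le_one hν0).mpr hν)
    (by linarith : 0 < 1 + c) (by linarith)
  convert h using 1
  funext m
  have hm : (0 : ℝ) ≤ m := Nat.cast_nonneg m
  have hcm : (0 : ℝ) < 1 + c + m := by linarith
  have hcm' : (0 : ℝ) < m + (1 + c) := by linarith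
  unfold pascuCoeff
  field_simp
  ring

/-- The bracket is `2 * pascuAverage - 1`, so the condition on `β` prescribes the extremal value at
`r = 1`. -/
theorem integral_bernardiWeight {μ ν ξ c : ℝ} (hμ : 0 < μ) (hν : 0 < ν) (hc : -1 < c) :
    ∫ t in (0 : ℝ)..1, bernardiWeight c t *
      ((1 - ξ) * gFun μ ν t + ξ * (2 * qFun μ ν t - 1)) =
    2 * ((1 + c) * powerAverage (1 + c) (pascuAverage μ ν ξ) 1) - 1 := by
  have hc' : 0 < 1 + c := by linarith
  have h : powerAverage (1 + c) (fun u => 2 * pascuAverage μ ν ξ u + (-1) * 1) 1 =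
      2 * powerAverage (1 + c) (pascuAverage μ ν ξ) 1
        + (-1) * powerAverage (1 + c) (fun _ => 1) 1 :=
    powerAverage_linear hc' (continuousOn_pascuAverage ξ hμ hν) continuousOn_const _ _ zero_le_one
  have h1 : powerAverage (1 + c) (fun _ => 1) 1 = 1 / (1 + c) := by
    simp only [powerAverage, mul_one, powerAverage_const hc']
  have h2 : ∫ t in (0 : ℝ)..1, bernardiWeight c t *
      ((1 - ξ) * gFun μ ν t + ξ * (2 * qFun μ ν t - 1)) =
      (1 + c) * powerAverage (1 + c) (fun u => 2 * pascuAverage μ ν ξ u + (-1) * 1) 1 := by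
    unfold powerAverage
    rw [← intervalIntegral.integral_const_mul]
    refine intervalIntegral.integral_congr fun t ht => ?_
    rw [Set.uIcc_of_le zero_le_one] at ht
    simp only [bernardiWeight, one_mul, pascuAverage_eq hμ hν ht.1, add_sub_cancel_left]
    ring
  rw [h2, h, h1]
  field_simp
  ring

/-- Extremality moves `z` to `-‖z‖`, and strict monotonicity moves `‖z‖` to `1`. The value at `1` is
taken from the integral, so no convergence of the series on the boundary is needed. -/
theorem re_tsum_pascuCoeff_gt {μ ν ξ c β : ℝ} (hξ0 : 0 ≤ ξ) (hξ1 : ξ ≤ 1) (hμ : 1 ≤ μ)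
    (hν : 1 ≤ ν) (hc : -1 < c) (hc2 : c ≤ 2)
    (hβ : β / (1 - β) = -∫ t in (0 : ℝ)..1, bernardiWeight c t *
      ((1 - ξ) * gFun μ ν t + ξ * (2 * qFun μ ν t - 1)))
    {u z : ℂ} (hu : u.re ^ 2 + u.im ^ 2 = 1) (hz : ‖z‖ < 1) :
    (1 - β / (1 - β)) / 2 <
      (∑' m : ℕ, (pascuCoeff μ ν ξ c m : ℂ) * ((1 + m * (u.re * u)) * z ^ m)).re := by
  have hμ0 : 0 < μ := by linarith
  have hν0 : 0 < ν := by linarith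
  have hr : ‖z‖ ∈ Set.Ico (0 : ℝ) 1 := ⟨norm_nonneg z, hz⟩
  have hext := pascuCoeff_extremal hξ0 hξ1 hμ hν hc hc2
  have hs := hasSum_pascuCoeff (ξ := ξ) hμ0 hν0 hc hr
  obtain ⟨B, hB⟩ := hext.bounded
  have hsum : Summable fun m : ℕ =>
      (pascuCoeff μ ν ξ c m : ℂ) * ((1 + m * (u.re * u)) * z ^ m) := by
    refine Summable.of_norm_bounded
      ((summable_one_add_mul_pow (norm_nonneg z) hz).mul_left B) fun m => ?_
    rw [norm_mul, norm_mul, norm_pow, Complex.norm_real, Real.norm_eq_abs]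
    exact mul_le_mul (hB m) (mul_le_mul_of_nonneg_right (norm_one_add_mul_le hu m)
      (by positivity)) (by positivity) ((abs_nonneg _).trans (hB 0))
  have h1 := (Complex.hasSum_re hsum.hasSum).sub hs
  have h2 : (fun m : ℕ => ((pascuCoeff μ ν ξ c m : ℂ) * ((1 + m * (u.re * u)) * z ^ m)).re
      - pascuCoeff μ ν ξ c m * ((1 + m) * (-‖z‖) ^ m))
      = fun m => pascuCoeff μ ν ξ c m * gapTerm u z m := by
    funext m
    rw [Complex.re_ofReal_mul, gapTerm, mul_sub]
  rw [h2] at h1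
  have h3 := hext.tsum_nonneg u z hu hz
  rw [h1.tsum_eq] at h3
  have h4 := strictAntiOn_powerAverage (by linarith : 0 < 1 + c)
    (continuousOn_pascuAverage ξ hμ0 hν0) (strictAntiOn_pascuAverage hμ0 hν0 hξ0 hξ1)
    ⟨hr.1, hr.2.le⟩ ⟨zero_le_one, le_rfl⟩ hr.2
  have h5 := mul_lt_mul_of_pos_left h4 (by linarith : 0 < 1 + c)
  rw [integral_bernardiWeight hμ0 hν0 hc] at hβ
  rw [hβ]
  linarith

/-! ### Parseval's identity and convolution. -/

theorem integral_exp_int_mul_I (k : ℤ) :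
    ∫ θ in (0 : ℝ)..2 * Real.pi, Complex.exp (k * θ * Complex.I) =
      if k = 0 then (2 * Real.pi : ℂ) else 0 := by
  split_ifs with h
  · simp [h]
  · have hc : (k * Complex.I : ℂ) ≠ 0 := mul_ne_zero (Int.cast_ne_zero.mpr h) Complex.I_ne_zero
    have := integral_exp_mul_complex (a := 0) (b := 2 * Real.pi) hc
    have e : ∀ θ : ℝ, Complex.exp (k * θ * Complex.I) = Complex.exp (k * Complex.I * θ) :=
      fun θ => by congr 1; ring
    simp only [e]
    rw [this]
    have h1 : Complex.exp (k * Complex.I * ((2 * Real.pi : ℝ) : ℂ)) = 1 := by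
      rw [← Complex.exp_int_mul_two_pi_mul_I k]
      congr 1
      push_cast; ring
    rw [h1]
    simp

theorem norm_exp_int_mul_I (k : ℤ) (θ : ℝ) : ‖Complex.exp (k * θ * Complex.I)‖ = 1 := by
  have := Complex.norm_exp_ofReal_mul_I (k * θ)
  push_cast at this
  exact this

theorem hasSum_integral_mul_exp {x : ℕ → ℂ} (hx : Summable fun m => ‖x m‖) (κ : ℕ → ℤ) {v : ℝ → ℂ}
    (hv : Continuous v) :
    HasSum (fun m => x m * ∫ θ in (0 : ℝ)..2 * Real.pi, Complex.exp (κ m * θ * Complex.I) * v θ)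
      (∫ θ in (0 : ℝ)..2 * Real.pi, (∑' m, x m * Complex.exp (κ m * θ * Complex.I)) * v θ) := by
  have key := intervalIntegral.hasSum_integral_of_dominated_convergence (μ := volume)
    (a := 0) (b := 2 * Real.pi)
    (F := fun (m : ℕ) θ => x m * (Complex.exp (κ m * θ * Complex.I) * v θ))
    (f := fun θ => (∑' m, x m * Complex.exp (κ m * θ * Complex.I)) * v θ)
    (fun m θ => ‖x m‖ * ‖v θ‖) (fun m => ?_) (fun m => ?_) ?_ ?_ ?_
  · simpa only [intervalIntegral.integral_const_mul] using key
  · exact (by fun_prop : Continuous fun θ : ℝ =>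
      x m * (Complex.exp (κ m * θ * Complex.I) * v θ)).aestronglyMeasurable
  · refine Eventually.of_forall fun θ _ => ?_
    rw [norm_mul, norm_mul, norm_exp_int_mul_I, one_mul]
  · exact Eventually.of_forall fun θ _ => hx.mul_right _
  · simp only [tsum_mul_right]
    exact (by fun_prop : Continuous fun θ => (∑' m, ‖x m‖) * ‖v θ‖).intervalIntegrable _ _
  · refine Eventually.of_forall fun θ _ => ?_
    have : Summable fun m => x m * Complex.exp (κ m * θ * Complex.I) := by
      refine Summable.of_norm (hx.congr fun m => ?_)
      rw [norm_mul, norm_exp_int_mul_I, mul_one]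
    simpa only [mul_assoc] using this.hasSum.mul_right (v θ)

theorem continuous_tsum_mul_exp {x : ℕ → ℂ} (hx : Summable fun m => ‖x m‖) (κ : ℕ → ℤ) :
    Continuous fun θ : ℝ => ∑' m, x m * Complex.exp (κ m * θ * Complex.I) := by
  refine continuous_tsum (fun m => by fun_prop) hx fun m θ => ?_
  rw [norm_mul, norm_exp_int_mul_I, mul_one]

theorem integral_exp_mul_tsum {y : ℕ → ℂ} (hy : Summable fun m => ‖y m‖) (κ : ℕ → ℤ) (k : ℤ) :
    HasSum (fun n => y n * if κ n + k = 0 then (2 * Real.pi : ℂ) else 0)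
      (∫ θ in (0 : ℝ)..2 * Real.pi, Complex.exp (k * θ * Complex.I) *
        ∑' n, y n * Complex.exp (κ n * θ * Complex.I)) := by
  have h := hasSum_integral_mul_exp hy κ
    (by fun_prop : Continuous fun θ : ℝ => Complex.exp (k * θ * Complex.I))
  have e : ∀ n, ∫ θ in (0 : ℝ)..2 * Real.pi,
      Complex.exp (κ n * θ * Complex.I) * Complex.exp (k * θ * Complex.I) =
      if κ n + k = 0 then (2 * Real.pi : ℂ) else 0 := fun n => by
    rw [← integral_exp_int_mul_I]
    refine intervalIntegral.integral_congr fun θ _ => ?_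
    rw [← Complex.exp_add]
    congr 1
    push_cast; ring
  simp only [e] at h
  simpa only [mul_comm] using h

/-- Parseval: the mean of `X · 2 Re Y` for `X = ∑ x m e^{imθ}` and `Y = ∑ y n e^{-inθ}`. -/
theorem integral_tsum_mul_two_re {x y : ℕ → ℂ} (hx : Summable fun m => ‖x m‖)
    (hy : Summable fun m => ‖y m‖) :
    ∫ θ in (0 : ℝ)..2 * Real.pi, (∑' m, x m * Complex.exp ((m : ℤ) * θ * Complex.I)) *
      ((2 * (∑' n, y n * Complex.exp ((-n : ℤ) * θ * Complex.I)).re : ℝ) : ℂ) =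
    2 * Real.pi * (∑' m, x m * y m + x 0 * starRingEnd ℂ (y 0)) := by
  set Y : ℝ → ℂ := fun θ => ∑' n, y n * Complex.exp ((-n : ℤ) * θ * Complex.I) with hY
  have hYc : Continuous Y := continuous_tsum_mul_exp hy fun n => (-n : ℤ)
  have hy' : Summable fun m => ‖starRingEnd ℂ (y m)‖ := by simpa using hy
  have hYs : ∀ θ, starRingEnd ℂ (Y θ) =
      ∑' n, starRingEnd ℂ (y n) * Complex.exp ((n : ℤ) * θ * Complex.I) := fun θ => by
    rw [hY, Complex.conj_tsum]
    refine tsum_congr fun n => ?_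
    rw [map_mul, ← Complex.exp_conj]
    simp
  have hv : Continuous fun θ => Y θ + starRingEnd ℂ (Y θ) :=
    hYc.add (Complex.continuous_conj.comp hYc)
  have h := hasSum_integral_mul_exp hx (fun m => (m : ℤ)) hv
  have e : ∀ θ, ((2 * (Y θ).re : ℝ) : ℂ) = Y θ + starRingEnd ℂ (Y θ) := fun θ =>
    (Complex.add_conj _).symm
  change ∫ θ in (0 : ℝ)..2 * Real.pi, (∑' m, x m * Complex.exp ((m : ℤ) * θ * Complex.I)) *
      ((2 * (Y θ).re : ℝ) : ℂ) = _
  simp only [e]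
  have hI : ∀ m : ℕ, ∫ θ in (0 : ℝ)..2 * Real.pi,
      Complex.exp ((m : ℤ) * θ * Complex.I) * (Y θ + starRingEnd ℂ (Y θ)) =
      2 * Real.pi * (y m + if m = 0 then starRingEnd ℂ (y 0) else 0) := fun m => by
    have hc : Continuous fun θ : ℝ => Complex.exp ((m : ℤ) * θ * Complex.I) := by fun_prop
    have c1 : Continuous fun θ : ℝ => Complex.exp ((m : ℤ) * θ * Complex.I) * Y θ := hc.mul hYc
    have c2 : Continuous fun θ : ℝ => Complex.exp ((m : ℤ) * θ * Complex.I) * starRingEnd ℂ (Y θ) :=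
      hc.mul (Complex.continuous_conj.comp hYc)
    simp only [mul_add]
    rw [intervalIntegral.integral_add (c1.intervalIntegrable _ _) (c2.intervalIntegrable _ _)]
    have h1 := integral_exp_mul_tsum hy (fun n => (-n : ℤ)) m
    have h2 := integral_exp_mul_tsum hy' (fun n => (n : ℤ)) m
    simp only [← hYs] at h2
    -- Orthogonality keeps only `n = m` in `Y`. In the conjugate series all frequencies `n + m` are
    -- nonnegative, so only `n = m = 0` contributes.
    have h1' := hasSum_single (f := fun n => y n *
      if (-n : ℤ) + m = 0 then (2 * Real.pi : ℂ) else 0)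
      m fun n hn => by
        have : (-n : ℤ) + m ≠ 0 := by omega
        simp [this]
    have h2' := hasSum_single (f := fun n => starRingEnd ℂ (y n) *
      if (n : ℤ) + m = 0 then (2 * Real.pi : ℂ) else 0) 0 fun n hn => by
        have : (n : ℤ) + m ≠ 0 := by omega
        simp [this]
    rw [h1.unique h1', h2.unique h2']
    rcases eq_or_ne m 0 with rfl | hm
    · simp; ring
    · simp [hm]; ring
  simp only [hI] at h
  rw [← h.tsum_eq, mul_add, ← tsum_mul_left]
  have hb : ∀ m, ‖y m‖ ≤ ∑' m, ‖y m‖ := fun m => hy.le_tsum m fun _ _ => norm_nonneg _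
  have hxy : Summable fun m => 2 * (Real.pi : ℂ) * (x m * y m) := by
    refine Summable.mul_left _ (Summable.of_norm_bounded (hx.mul_right (∑' m, ‖y m‖)) fun m => ?_)
    rw [norm_mul]
    exact mul_le_mul_of_nonneg_left (hb m) (norm_nonneg _)
  have h0 := hasSum_single (f := fun m : ℕ => if m = 0 then
    2 * (Real.pi : ℂ) * (x 0 * starRingEnd ℂ (y 0)) else 0) 0 fun n hn => by simp [hn]
  simp only [if_true] at h0
  rw [← (hxy.hasSum.add h0).tsum_eq]
  refine tsum_congr fun m => ?_
  rcases eq_or_ne m 0 with rfl | hm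
  · simp; ring
  · simp [hm]; ring

/-- The mean of the positive function `2 (Re X - b) Re Y` is computed by Parseval; `x 0 = 1` makes
the extra term there equal to `Re (y 0)`. -/
theorem lt_re_tsum_mul {x y : ℕ → ℂ} (hx : Summable fun m => ‖x m‖)
    (hy : Summable fun m => ‖y m‖) (hx0 : x 0 = 1) {b : ℝ}
    (hX : ∀ θ : ℝ, b < (∑' m, x m * Complex.exp ((m : ℤ) * θ * Complex.I)).re)
    (hY : ∀ θ : ℝ, 0 < (∑' n, y n * Complex.exp ((-n : ℤ) * θ * Complex.I)).re) :
    (2 * b - 1) * (y 0).re < (∑' m, x m * y m).re := by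
  have hXc := continuous_tsum_mul_exp hx fun n => (n : ℤ)
  have hYc := continuous_tsum_mul_exp hy fun n => (-n : ℤ)
  have hP := congrArg Complex.re (integral_tsum_mul_two_re hx hy)
  have hM := congrArg Complex.re (integral_exp_mul_tsum hy (fun n => (-n : ℤ)) 0).tsum_eq
  set X : ℝ → ℂ := fun θ => ∑' m, x m * Complex.exp ((m : ℤ) * θ * Complex.I)
  set Y : ℝ → ℂ := fun θ => ∑' n, y n * Complex.exp ((-n : ℤ) * θ * Complex.I)
  have hpi : 0 < 2 * Real.pi := Real.two_pi_pos
  have hre : ∀ {v : ℝ → ℂ}, Continuous v → (∫ θ in (0 : ℝ)..2 * Real.pi, v θ).re =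
      ∫ θ in (0 : ℝ)..2 * Real.pi, (v θ).re := fun hv =>
    (intervalIntegral.intervalIntegral_re (hv.intervalIntegrable _ _)).symm
  have hpos : 0 < ∫ θ in (0 : ℝ)..2 * Real.pi, 2 * (((X θ).re - b) * (Y θ).re) := by
    refine intervalIntegral.intervalIntegral_pos_of_pos_on ?_ (fun θ _ => ?_) hpi
    · exact (continuous_const.mul (((Complex.continuous_re.comp hXc).sub continuous_const).mul
        (Complex.continuous_re.comp hYc))).intervalIntegrable _ _
    · exact mul_pos two_pos (mul_pos (sub_pos.mpr (hX θ)) (hY θ))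
  have hmean : ∫ θ in (0 : ℝ)..2 * Real.pi, (Y θ).re = 2 * Real.pi * (y 0).re := by
    rw [tsum_eq_single 0 fun n hn => by simp [hn]] at hM
    simp only [Int.cast_zero, zero_mul, Complex.exp_zero, one_mul] at hM
    rw [hre hYc] at hM
    rw [← hM]
    simp
    ring
  have hprod : ∫ θ in (0 : ℝ)..2 * Real.pi, (X θ).re * (2 * (Y θ).re) =
      2 * Real.pi * ((∑' m, x m * y m).re + (y 0).re) := by
    change (∫ θ in (0 : ℝ)..2 * Real.pi, X θ * ((2 * (Y θ).re : ℝ) : ℂ)).re = _ at hP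
    rw [hre (by fun_prop : Continuous fun θ => X θ * ((2 * (Y θ).re : ℝ) : ℂ))] at hP
    have : ((2 * Real.pi : ℝ) : ℂ) = 2 * Real.pi := by push_cast; ring
    rw [← this, Complex.re_ofReal_mul, hx0] at hP
    simpa [Complex.re_mul_ofReal] using hP
  have hsplit : ∫ θ in (0 : ℝ)..2 * Real.pi, 2 * (((X θ).re - b) * (Y θ).re) =
      (∫ θ in (0 : ℝ)..2 * Real.pi, (X θ).re * (2 * (Y θ).re))
        - 2 * b * ∫ θ in (0 : ℝ)..2 * Real.pi, (Y θ).re := by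
    have c1 : Continuous fun θ => (X θ).re * (2 * (Y θ).re) := by fun_prop
    have c2 : Continuous fun θ => 2 * b * (Y θ).re := by fun_prop
    rw [← intervalIntegral.integral_const_mul, ← intervalIntegral.integral_sub
      (c1.intervalIntegrable _ _) (c2.intervalIntegrable _ _)]
    refine intervalIntegral.integral_congr fun θ _ => ?_
    ring
  rw [hsplit, hprod, hmean] at hpos
  have : 0 < 2 * Real.pi * ((∑' m, x m * y m).re + (y 0).re - 2 * b * (y 0).re) := by linarith
  have := (mul_pos_iff_of_pos_left hpi).mp this
  linarith

/-- Convolution of a series with real part above `b` and a series with positive real part. -/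
theorem lt_re_tsum_convolution {k q : ℕ → ℂ} (hk0 : k 0 = 1)
    (hk : ∀ z : ℂ, ‖z‖ < 1 → Summable fun m => ‖k m * z ^ m‖)
    (hq : ∀ z : ℂ, ‖z‖ < 1 → Summable fun m => ‖q m * z ^ m‖) {b : ℝ}
    (hK : ∀ z : ℂ, ‖z‖ < 1 → b < (∑' m, k m * z ^ m).re)
    (hQ : ∀ z : ℂ, ‖z‖ < 1 → 0 < (∑' m, q m * z ^ m).re) {z : ℂ} (hz : ‖z‖ < 1) :
    (2 * b - 1) * (q 0).re < (∑' m, k m * q m * z ^ m).re := by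
  -- Writing `z = (z/ρ) · ρ` puts both series on circles inside the disc, where they converge
  -- absolutely.
  obtain ⟨ρ, hρz, hρ1⟩ := exists_between hz
  have hρ0 : 0 < ρ := (norm_nonneg z).trans_lt hρz
  have hρn : ‖(ρ : ℂ)‖ = ρ := by rw [Complex.norm_real, Real.norm_of_nonneg hρ0.le]
  have hρc : (ρ : ℂ) ≠ 0 := Complex.ofReal_ne_zero.mpr hρ0.ne'
  have hw : ‖z / ρ‖ < 1 := by rw [norm_div, hρn, div_lt_one hρ0]; exact hρz
  have h := lt_re_tsum_mul (hk _ hw) (hq ρ (hρn.trans_lt hρ1)) (by simp [hk0]) (b := b)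
    (fun θ => ?_) (fun θ => ?_)
  · rw [pow_zero, mul_one] at h
    refine h.trans_eq (congrArg Complex.re (tsum_congr fun m => ?_))
    rw [div_pow]
    field_simp
  · have h1 := hK (z / ρ * Complex.exp ((1 : ℤ) * θ * Complex.I))
      (by rwa [norm_mul, norm_exp_int_mul_I, mul_one])
    refine h1.trans_eq (congrArg Complex.re (tsum_congr fun m => ?_))
    rw [mul_pow, ← Complex.exp_nat_mul, mul_assoc (k m)]
    congr 3
    push_cast; ring
  · have h1 := hQ (ρ * Complex.exp ((-1 : ℤ) * θ * Complex.I))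
      (by rw [norm_mul, norm_exp_int_mul_I, mul_one, hρn]; exact hρ1)
    refine h1.trans_eq (congrArg Complex.re (tsum_congr fun m => ?_))
    rw [mul_pow, ← Complex.exp_nat_mul, mul_assoc (q m)]
    congr 3
    push_cast; ring

/-! ### Power series in the unit disc. -/

/-- `f` is the sum of the power series `∑ a n zⁿ` in the open unit disc. -/
def HasDiscSeries (a : ℕ → ℂ) (f : ℂ → ℂ) : Prop :=
  ∀ z : ℂ, ‖z‖ < 1 → HasSum (fun n => a n * z ^ n) (f z)

theorem hasDiscSeries_taylor {f : ℂ → ℂ} (hf : DifferentiableOn ℂ f (Metric.ball 0 1)) :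
    HasDiscSeries (fun n => (n.factorial : ℂ)⁻¹ * iteratedDeriv n f 0) f := fun z hz => by
  have h := Complex.hasSum_taylorSeries_on_ball hf (mem_ball_zero_iff.mpr hz)
  refine Eq.mp (congrArg (HasSum · _) (funext fun n => ?_)) h
  rw [sub_zero, smul_eq_mul, smul_eq_mul]
  ring

namespace HasDiscSeries

variable {a b : ℕ → ℂ} {f g : ℂ → ℂ}

theorem summable_norm (h : HasDiscSeries a f) {z : ℂ} (hz : ‖z‖ < 1) :
    Summable fun n => ‖a n * z ^ n‖ := (h z hz).summable.norm

theorem differentiableAt_and_hasSum_deriv (h : HasDiscSeries a f) {z : ℂ} (hz : ‖z‖ < 1) :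
    DifferentiableAt ℂ f z ∧ HasSum (fun n => a n * (n * z ^ (n - 1))) (deriv f z) := by
  obtain ⟨ρ, hρz, hρ1⟩ := exists_between hz
  have hρ0 : 0 < ρ := (norm_nonneg z).trans_lt hρz
  have hρn : ‖(ρ : ℂ)‖ = ρ := by rw [Complex.norm_real, Real.norm_of_nonneg hρ0.le]
  have hsum : Summable fun n => ‖a n‖ * ρ ^ n := by
    refine (h.summable_norm (z := ρ) (hρn.trans_lt hρ1)).congr fun n => ?_
    rw [norm_mul, norm_pow, hρn]
  have hdiff : ∀ n, DifferentiableOn ℂ (fun w => a n * w ^ n) (Metric.ball 0 ρ) := fun n => by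
    fun_prop
  have hbd : ∀ n, ∀ w ∈ Metric.ball (0 : ℂ) ρ, ‖a n * w ^ n‖ ≤ ‖a n‖ * ρ ^ n := fun n w hw => by
    rw [norm_mul, norm_pow]
    have := (mem_ball_zero_iff.mp hw).le
    gcongr
  have hz' : z ∈ Metric.ball (0 : ℂ) ρ := mem_ball_zero_iff.mpr hρz
  have heq : (fun w => ∑' n, a n * w ^ n) =ᶠ[𝓝 z] f := by
    filter_upwards [Metric.isOpen_ball.mem_nhds hz'] with w hw
    exact (h w ((mem_ball_zero_iff.mp hw).trans hρ1)).tsum_eq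
  have h1 := Complex.hasSum_deriv_of_summable_norm hsum hdiff Metric.isOpen_ball hbd hz'
  have h2 := (Complex.differentiableOn_tsum_of_summable_norm hsum hdiff Metric.isOpen_ball
    hbd).differentiableAt (Metric.isOpen_ball.mem_nhds hz')
  rw [heq.deriv_eq] at h1
  refine ⟨heq.differentiableAt_iff.mp h2, Eq.mp (congrArg (HasSum · _) (funext fun n => ?_)) h1⟩
  simp

theorem differentiableOn (h : HasDiscSeries a f) : DifferentiableOn ℂ f (Metric.ball 0 1) :=
  fun _ hz => (h.differentiableAt_and_hasSum_deriv
    (mem_ball_zero_iff.mp hz)).1.differentiableWithinAt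

theorem apply_zero (h : HasDiscSeries a f) : f 0 = a 0 := by
  have h1 := h 0 (by simp)
  have h2 := hasSum_single (f := fun n => a n * (0 : ℂ) ^ n) 0 fun n hn => by simp [hn]
  simpa using h1.unique h2

theorem deriv_zero (h : HasDiscSeries a f) : deriv f 0 = a 1 := by
  have h1 := (h.differentiableAt_and_hasSum_deriv (z := 0) (by simp)).2
  have h2 := hasSum_single (f := fun n : ℕ => a n * (n * (0 : ℂ) ^ (n - 1))) 1 fun n hn => by
    rcases n with _ | _ | n <;> simp_all
  simpa using h1.unique h2

theorem mul_deriv (h : HasDiscSeries a f) :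
    HasDiscSeries (fun n => n * a n) fun z => z * deriv f z := fun z hz => by
  have h1 := (h.differentiableAt_and_hasSum_deriv hz).2.mul_left z
  refine Eq.mp (congrArg (HasSum · _) (funext fun n => ?_)) h1
  rcases n with _ | n
  · simp
  · simp only [Nat.add_sub_cancel, pow_succ]
    ring

theorem linearCombination (ha : HasDiscSeries a f) (hb : HasDiscSeries b g) (p q : ℂ) :
    HasDiscSeries (fun n => p * a n + q * b n) fun z => p * f z + q * g z := fun z hz => by
  refine Eq.mp (congrArg (HasSum · _) (funext fun n => ?_))
    (((ha z hz).mul_left p).add ((hb z hz).mul_left q))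
  ring

/-- Division by `z` of a series without constant term. -/
theorem hasSum_succ (h : HasDiscSeries a f) (h0 : a 0 = 0) {z : ℂ} (hz : ‖z‖ < 1) (hz0 : z ≠ 0) :
    HasSum (fun m => a (m + 1) * z ^ m) (f z / z) := by
  have h1 := (hasSum_nat_add_iff' 1).mpr (h z hz)
  simp only [Finset.range_one, Finset.sum_singleton, h0, zero_mul, sub_zero] at h1
  refine Eq.mp (congrArg (HasSum · _) (funext fun n => ?_)) (h1.div_const z)
  rw [pow_succ]
  field_simp

end HasDiscSeries

/-- Since `a 0 = 0`, one factor `t` of `f (t z)` joins `t ^ (c - 1)`, giving the integrable weight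
`t ^ c`. For `n = 0`, `c = 0` the quotient `(1 + c)/(c + n)` is a division by zero, harmless because
it multiplies `a 0`. -/
theorem hasDiscSeries_bernardiOperator {a : ℕ → ℂ} {f : ℂ → ℂ} (h : HasDiscSeries a f)
    (h0 : a 0 = 0) {c : ℝ} (hc : -1 < c) :
    HasDiscSeries (fun n => (1 + c) / (c + n) * a n) (bernardiOperator c f) := fun z hz => by
  have hs : Summable fun m => ‖a (m + 1) * z ^ (m + 1)‖ :=
    (summable_nat_add_iff 1).mpr (h.summable_norm hz)
  have key := (hasSum_integral_rpow_smul hs (by linarith : 0 < 1 + c)).mul_left (1 + c : ℂ)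
  have e : bernardiOperator c f z = (1 + c) * ∫ s in (0 : ℝ)..1, s ^ ((1 + c) - 1) •
      ∑' m : ℕ, s ^ m • (a (m + 1) * z ^ (m + 1)) := by
    unfold bernardiOperator
    congr 1
    refine intervalIntegral.integral_congr_ae (Eventually.of_forall fun s hs => ?_)
    rw [Set.uIoc_of_le zero_le_one] at hs
    have hsz : ‖(s : ℂ) * z‖ < 1 := by
      rw [norm_mul, Complex.norm_real, Real.norm_of_nonneg hs.1.le]
      exact (mul_le_of_le_one_left (norm_nonneg z) hs.2).trans_lt hz
    have h1 := (hasSum_nat_add_iff' 1).mpr (h _ hsz)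
    simp only [Finset.range_one, Finset.sum_singleton, h0, zero_mul, sub_zero] at h1
    rw [← h1.tsum_eq, add_sub_cancel_left, Complex.real_smul, ← tsum_mul_left, ← tsum_mul_left]
    refine tsum_congr fun m => ?_
    have hsc : (s : ℂ) ≠ 0 := Complex.ofReal_ne_zero.mpr hs.1.ne'
    rw [Real.rpow_sub_one hs.1.ne', Complex.real_smul]
    push_cast
    field_simp
    ring
  rw [e]
  refine (hasSum_nat_add_iff' 1).mp ?_
  simp only [Finset.range_one, Finset.sum_singleton, h0, mul_zero, zero_mul, sub_zero]
  refine Eq.mp (congrArg (HasSum · _) (funext fun m => ?_)) key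
  rw [Complex.real_smul]
  push_cast
  rw [show (m : ℂ) + (1 + c) = c + (m + 1) by ring]
  ring

theorem normalizedAnalytic_bernardiOperator {a : ℕ → ℂ} {f : ℂ → ℂ} (h : HasDiscSeries a f)
    (h0 : a 0 = 0) (h1 : a 1 = 1) {c : ℝ} (hc : -1 < c) :
    NormalizedAnalytic (bernardiOperator c f) := by
  have hF := hasDiscSeries_bernardiOperator h h0 hc
  refine ⟨hF.differentiableOn, ?_, ?_⟩
  · rw [hF.apply_zero, h0, mul_zero]
  · have : (1 + c : ℂ) ≠ 0 := by
      rw [← Complex.ofReal_one, ← Complex.ofReal_add]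
      exact Complex.ofReal_ne_zero.mpr (by linarith)
    rw [hF.deriv_zero, h1, mul_one, Nat.cast_one, add_comm (c : ℂ), div_self this]

/-- Taylor series of the expression in the definition of `classW`. -/
theorem hasSum_classW {a : ℕ → ℂ} {f : ℂ → ℂ} (h : HasDiscSeries a f) (h0 : a 0 = 0) (h1 : a 1 = 1)
    {α γ μ ν : ℝ} (hsum : μ + ν = α - γ) (hprod : μ * ν = γ) {z : ℂ} (hz : ‖z‖ < 1) :
    HasSum (fun m : ℕ => (1 + μ * m) * (1 + ν * m) * a (m + 1) * z ^ m)
      ((1 - α + 2 * γ) * dslope f 0 z + (α - 2 * γ) * deriv f z + γ * z * deriv (deriv f) z) := by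
  have hα : (α : ℂ) = μ + ν + μ * ν := by
    have : α = μ + ν + μ * ν := by linarith
    rw [this]; push_cast; ring
  have hγ : (γ : ℂ) = μ * ν := by rw [← hprod]; push_cast; ring
  have hf0 : f 0 = 0 := h.apply_zero.trans h0
  rcases eq_or_ne z 0 with rfl | hz0
  · rw [dslope_same, h.deriv_zero, h1]
    have := hasSum_single (f := fun m : ℕ => (1 + μ * m) * (1 + ν * m) * a (m + 1) * (0 : ℂ) ^ m) 0
      fun m hm => by simp [hm]
    simp only [h1] at this
    convert this using 1
    simp
  · have hd := h.mul_deriv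
    have hdd := hd.mul_deriv
    -- Rewriting `γ z² f''` as `γ z (z f')' - γ z f'` changes `α - 2γ` into `α - 3γ`. At `n = m + 1`
    -- the coefficient becomes `1 + (α - γ) m + γ m² = (1 + μ m)(1 + ν m)`.
    have hs := ((h.linearCombination hd (1 - α + 2 * γ) (α - 3 * γ)).linearCombination hdd 1 γ)
    have hs' := hs.hasSum_succ (by simp [h0]) hz hz0
    have hdiff : DifferentiableAt ℂ (deriv f) z :=
      (h.differentiableOn.deriv Metric.isOpen_ball).differentiableAt
        (Metric.isOpen_ball.mem_nhds (mem_ball_zero_iff.mpr hz))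
    have hder : deriv (fun w => w * deriv f w) z = deriv f z + z * deriv (deriv f) z := by
      rw [deriv_fun_mul differentiableAt_fun_id hdiff]
      simp
    rw [hder] at hs'
    rw [dslope_of_ne _ hz0, slope_def_field, hf0, sub_zero, sub_zero]
    have e : (1 * ((1 - α + 2 * γ) * f z + (α - 3 * γ) * (z * deriv f z))
        + γ * (z * (deriv f z + z * deriv (deriv f) z))) / z =
        (1 - α + 2 * γ) * (f z / z) + (α - 2 * γ) * deriv f z + γ * z * deriv (deriv f) z := by
      field_simp
      ring
    rw [e] at hs'
    refine Eq.mp (congrArg (HasSum · _) (funext fun m => ?_)) hs'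
    rw [hα, hγ]
    push_cast
    ring

/-! ### Nonvanishing of the pencil and conclusion. -/

/-- Membership in `classM` from the nonvanishing of a pencil. -/
theorem re_div_pos_of_forall_ne_zero {G N : ℂ}
    (h : ∀ ε : ℂ, ‖ε‖ ≤ 1 → (1 - ε) / 2 * G + (1 + ε) / 2 * N ≠ 0) : 0 < (N / G).re := by
  by_contra! hre
  have hG : G ≠ 0 := by
    have := h (-1) (by simp)
    norm_num at this
    exact this
  set w := N / G with hw
  have hN : N = w * G := by rw [hw]; field_simp
  have h1 : 1 - w ≠ 0 := fun h0 => by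
    have := congrArg Complex.re h0
    simp at this
    linarith
  -- The Cayley transform of `w` is the root of the pencil, and it lies in the closed disc because
  -- `Re w ≤ 0`.
  refine h ((1 + w) / (1 - w)) ?_ ?_
  · rw [norm_div, div_le_one (norm_pos_iff.mpr h1), ← sq_le_sq₀ (norm_nonneg _) (norm_nonneg _),
      ← Complex.normSq_eq_norm_sq, ← Complex.normSq_eq_norm_sq, Complex.normSq_apply,
      Complex.normSq_apply]
    simp
    nlinarith
  · rw [hN]
    field_simp
    ring

/-- For `u = e^{iθ/2}` one has `Re(u) u = (1 + e^{iθ})/2`, and `v = i u` gives the antipodal point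
`(1 - e^{iθ})/2`. With `θ = arg ε`, the point `(1 + ε)/2` lies on the diameter joining them. -/
theorem exists_unit_convex_combination {ε : ℂ} (hε : ‖ε‖ ≤ 1) :
    ∃ (u v : ℂ) (p : ℝ), u.re ^ 2 + u.im ^ 2 = 1 ∧ v.re ^ 2 + v.im ^ 2 = 1 ∧ 0 ≤ p ∧ p ≤ 1 ∧
      (1 + ε) / 2 = p * (u.re * u) + (1 - p) * (v.re * v) := by
  have h2 : ε.arg = 2 * (ε.arg / 2) := by ring
  have hcs := Real.sin_sq_add_cos_sq (ε.arg / 2)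
  have hre : ε.re = ‖ε‖ * (2 * Real.cos (ε.arg / 2) ^ 2 - 1) := by
    rw [← Real.cos_two_mul, ← h2, Complex.norm_mul_cos_arg]
  have him : ε.im = ‖ε‖ * (2 * Real.sin (ε.arg / 2) * Real.cos (ε.arg / 2)) := by
    rw [← Real.sin_two_mul, ← h2, Complex.norm_mul_sin_arg]
  generalize Real.cos (ε.arg / 2) = C at *
  generalize Real.sin (ε.arg / 2) = S at *
  refine ⟨⟨C, S⟩, ⟨-S, C⟩, (1 + ‖ε‖) / 2, by simpa [add_comm] using hcs,
    by simpa using hcs, by positivity, by linarith, ?_⟩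
  have hp : ((1 + ‖ε‖) / 2 : ℝ) = ((1 + ‖ε‖) / 2 : ℂ) := by push_cast; ring
  rw [hp]
  apply Complex.ext
  · simp [hre]
    linear_combination (-1 / 2 + ‖ε‖ / 2) * hcs
  · simp [him]
    ring

/-- The bound of `re_tsum_pascuCoeff_gt` for every multiplier `1 + m (1 + ε) / 2` with `‖ε‖ ≤ 1`. -/
theorem re_tsum_pascuCoeff_disc_gt {μ ν ξ c β : ℝ} (hξ0 : 0 ≤ ξ) (hξ1 : ξ ≤ 1) (hμ : 1 ≤ μ)
    (hν : 1 ≤ ν) (hc : -1 < c) (hc2 : c ≤ 2)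
    (hβ : β / (1 - β) = -∫ t in (0 : ℝ)..1, bernardiWeight c t *
      ((1 - ξ) * gFun μ ν t + ξ * (2 * qFun μ ν t - 1)))
    {ε z : ℂ} (hε : ‖ε‖ ≤ 1) (hz : ‖z‖ < 1) :
    (Summable fun m : ℕ => ‖(pascuCoeff μ ν ξ c m : ℂ) * (1 + m * ((1 + ε) / 2)) * z ^ m‖) ∧
    (1 - β / (1 - β)) / 2 <
      (∑' m : ℕ, (pascuCoeff μ ν ξ c m : ℂ) * (1 + m * ((1 + ε) / 2)) * z ^ m).re := by
  obtain ⟨B, hB⟩ := (pascuCoeff_extremal hξ0 hξ1 hμ hν hc hc2).bounded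
  have hsum : ∀ u : ℂ, u.re ^ 2 + u.im ^ 2 = 1 → Summable fun m : ℕ =>
      (pascuCoeff μ ν ξ c m : ℂ) * ((1 + m * (u.re * u)) * z ^ m) := fun u hu => by
    refine Summable.of_norm_bounded
      ((summable_one_add_mul_pow (norm_nonneg z) hz).mul_left B) fun m => ?_
    rw [norm_mul, norm_mul, norm_pow, Complex.norm_real, Real.norm_eq_abs]
    exact mul_le_mul (hB m) (mul_le_mul_of_nonneg_right (norm_one_add_mul_le hu m)
      (by positivity)) (by positivity) ((abs_nonneg _).trans (hB 0))
  obtain ⟨u, v, p, hu, hv, hp0, hp1, he⟩ := exists_unit_convex_combination hε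
  have h := ((hsum u hu).hasSum.mul_left (p : ℂ)).add ((hsum v hv).hasSum.mul_left (1 - p : ℂ))
  have e : (fun m : ℕ => (p : ℂ) * ((pascuCoeff μ ν ξ c m : ℂ) * ((1 + m * (u.re * u)) * z ^ m))
      + (1 - p) * ((pascuCoeff μ ν ξ c m : ℂ) * ((1 + m * (v.re * v)) * z ^ m))) =
      fun m : ℕ => (pascuCoeff μ ν ξ c m : ℂ) * (1 + m * ((1 + ε) / 2)) * z ^ m := by
    funext m
    rw [he]
    ring
  rw [e] at h
  refine ⟨h.summable.norm, ?_⟩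
  have h1 := re_tsum_pascuCoeff_gt hξ0 hξ1 hμ hν hc hc2 hβ hu hz
  have h2 := re_tsum_pascuCoeff_gt hξ0 hξ1 hμ hν hc hc2 hβ hv hz
  rw [h.tsum_eq, Complex.add_re, Complex.re_ofReal_mul, ← Complex.ofReal_one, ← Complex.ofReal_sub,
    Complex.re_ofReal_mul, Complex.ofReal_one]
  rcases hp0.eq_or_lt with rfl | hp
  · simpa using h2
  · nlinarith [mul_lt_mul_of_pos_left h1 hp, mul_le_mul_of_nonneg_left h2.le (sub_nonneg.mpr hp1)]

/-- The convolution of a function in `classW` with the multiplier sequence has no zeros. -/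
theorem tsum_pascuCoeff_mul_ne_zero {μ ν ξ c β φ : ℝ} (hξ0 : 0 ≤ ξ) (hξ1 : ξ ≤ 1) (hμ : 1 ≤ μ)
    (hν : 1 ≤ ν) (hc : -1 < c) (hc2 : c ≤ 2) (hβ1 : β < 1)
    (hβ : β / (1 - β) = -∫ t in (0 : ℝ)..1, bernardiWeight c t *
      ((1 - ξ) * gFun μ ν t + ξ * (2 * qFun μ ν t - 1)))
    {h : ℕ → ℂ} {H : ℂ → ℂ} (hH : HasDiscSeries h H) (h0 : h 0 = 1)
    (hre : ∀ z : ℂ, ‖z‖ < 1 → 0 < (Complex.exp (Complex.I * φ) * (H z - β)).re)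
    {ε z : ℂ} (hε : ‖ε‖ ≤ 1) (hz : ‖z‖ < 1) :
    ∑' m : ℕ, (pascuCoeff μ ν ξ c m : ℂ) * (1 + m * ((1 + ε) / 2)) * h m * z ^ m ≠ 0 := by
  set E := Complex.exp (Complex.I * φ)
  set k : ℕ → ℂ := fun m => (pascuCoeff μ ν ξ c m : ℂ) * (1 + m * ((1 + ε) / 2)) with hk
  have hk0 : k 0 = 1 := by
    have : pascuCoeff μ ν ξ c 0 = 1 := by
      have : 1 + c ≠ 0 := by linarith
      simp [pascuCoeff, this]
    simp [hk, this]
  have hK := fun z hz => re_tsum_pascuCoeff_disc_gt hξ0 hξ1 hμ hν hc hc2 hβ (z := z) hε hz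
  -- Subtracting `β` affects only the constant coefficient, so the convolution with `Q` is `E` times
  -- the one with `H`, minus `E β`.
  have hQ : HasDiscSeries (fun m => E * (h m - if m = 0 then (β : ℂ) else 0))
      fun z => E * (H z - β) := fun z hz => by
    have h1 := hasSum_single (f := fun m : ℕ => (if m = 0 then (β : ℂ) else 0) * z ^ m) 0
      fun m hm => by simp [hm]
    simp only [if_true, pow_zero, mul_one] at h1
    refine Eq.mp (congrArg (HasSum · _) (funext fun m => ?_)) (((hH z hz).sub h1).mul_left E)
    ring
  have key := lt_re_tsum_convolution hk0 (fun z hz => (hK z hz).1) (fun z hz => hQ.summable_norm hz)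
    (fun z hz => (hK z hz).2) (fun z hz => by rw [(hQ z hz).tsum_eq]; exact hre z hz) hz
  have hs : Summable fun m => k m * h m * z ^ m := by
    obtain ⟨B, hB⟩ := (pascuCoeff_extremal hξ0 hξ1 hμ hν hc hc2).bounded
    refine Summable.of_norm_bounded ((((hH.mul_deriv).summable_norm hz).add
      (hH.summable_norm hz)).mul_left B) fun m => ?_
    have h1 : ‖(1 + ε) / 2‖ ≤ 1 := by
      rw [norm_div, Complex.norm_ofNat, div_le_one two_pos]
      refine (norm_add_le _ _).trans ?_
      rw [norm_one]
      linarith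
    have h2 : ‖(1 + m * ((1 + ε) / 2) : ℂ)‖ ≤ 1 + m := by
      refine (norm_add_le _ _).trans ?_
      rw [norm_one, norm_mul, Complex.norm_natCast]
      nlinarith [Nat.cast_nonneg (α := ℝ) m]
    rw [hk, mul_assoc, norm_mul, norm_mul, Complex.norm_real, Real.norm_eq_abs, mul_assoc,
      mul_assoc, norm_mul (m : ℂ), Complex.norm_natCast]
    refine mul_le_mul (hB m) ?_ (by positivity) ((abs_nonneg _).trans (hB 0))
    nlinarith [mul_le_mul_of_nonneg_right h2 (norm_nonneg (h m * z ^ m))]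
  have e : ∀ m, k m * (E * (h m - if m = 0 then (β : ℂ) else 0)) * z ^ m =
      E * (k m * h m * z ^ m) - if m = 0 then E * β else 0 := fun m => by
    rcases eq_or_ne m 0 with rfl | hm
    · simp only [hk0, if_true]
      ring
    · simp only [if_neg hm]
      ring
  simp only [e] at key
  have hsum := (hs.hasSum.mul_left E).sub (hasSum_ite_eq 0 (E * (β : ℂ)))
  rw [hsum.tsum_eq] at key
  intro hzero
  rw [hzero, h0] at key
  -- With this `b` the lower bound is exactly `-β Re E`, the real part of the constant just split
  -- off; a zero of the convolution would give `-β Re E < -β Re E`.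
  have h3 : (2 * ((1 - β / (1 - β)) / 2) - 1) * (1 - β) = -β := by
    have : 1 - β ≠ 0 := by linarith
    field_simp
    ring
  have h4 : (E * (1 - (β : ℂ))).re = (1 - β) * E.re := by
    rw [mul_comm, ← Complex.ofReal_one, ← Complex.ofReal_sub, Complex.re_ofReal_mul]
  rw [if_pos trivial, h4, mul_zero, zero_sub, Complex.neg_re, mul_comm E, Complex.re_ofReal_mul,
    ← mul_assoc, h3, neg_mul] at key
  exact lt_irrefl _ key

theorem mainTheorem3 (α γ β ξ μ ν c : ℝ)
    (hξ0 : 0 ≤ ξ) (hξ1 : ξ ≤ 1) (hμ : 1 ≤ μ) (hμν : μ ≤ ν)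
    (hsum : μ + ν = α - γ) (hprod : μ * ν = γ)
    (hc : -1 < c) (hc' : c ≤ min (1 + 1 / μ - 1 / ν) ((1 + 1 / μ - ξ) / (1 + 2 * ξ)))
    (hβ : β < 1)
    (hβ' : β / (1 - β) = -∫ t in (0 : ℝ)..1, bernardiWeight c t *
      ((1 - ξ) * gFun μ ν t + ξ * (2 * qFun μ ν t - 1)))
    (f : ℂ → ℂ) (hf : f ∈ classW α γ β) :
    bernardiOperator c f ∈ classM ξ := by
  obtain ⟨hfA, φ, hφ⟩ := hf
  have hν : 1 ≤ ν := hμ.trans hμν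
  -- This is the condition `C ≤ 3` of `ExtremalMultiplier.product` for `C = 1 + c`.
  have hc2 : c ≤ 2 := by
    have h1 := hc'.trans (min_le_left _ _)
    have h2 : 1 / μ ≤ 1 := (div_le_one (by linarith)).mpr hμ
    have h3 : 0 < 1 / ν := one_div_pos.mpr (by linarith)
    linarith
  obtain ⟨a, ha⟩ : ∃ a, HasDiscSeries a f := ⟨_, hasDiscSeries_taylor hfA.differentiableOn⟩
  have ha0 : a 0 = 0 := ha.apply_zero.symm.trans hfA.map_zero
  have ha1 : a 1 = 1 := ha.deriv_zero.symm.trans hfA.deriv_zero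
  refine ⟨normalizedAnalytic_bernardiOperator ha ha0 ha1 hc, fun z hz hz0 => ?_⟩
  rw [mem_ball_zero_iff] at hz
  have hH : HasDiscSeries (fun m => (1 + μ * m) * (1 + ν * m) * a (m + 1)) _ :=
    fun z hz => hasSum_classW ha ha0 ha1 hsum hprod hz
  have hF := hasDiscSeries_bernardiOperator ha ha0 hc
  have hF' := hF.mul_deriv
  have hF'' := hF'.mul_deriv
  refine re_div_pos_of_forall_ne_zero fun ε hε hzero => ?_
  have hne := tsum_pascuCoeff_mul_ne_zero hξ0 hξ1 hμ hν hc hc2 hβ hβ' hH (by simp [ha1])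
    (fun z hz => hφ z (mem_ball_zero_iff.mpr hz)) hε hz
  -- At `n = m + 1` the two combinations contribute `ξ n + 1 - ξ = 1 + ξ m` and `(1 - ε)/2 + n (1 +
  -- ε)/2 = 1 + m (1 + ε)/2`.
  have hs := ((hF'.linearCombination hF ξ (1 - ξ)).linearCombination
    (hF''.linearCombination hF' ξ (1 - ξ)) ((1 - ε) / 2) ((1 + ε) / 2)).hasSum_succ
    (by simp [ha0]) hz hz0
  refine hne (Eq.trans (Eq.trans (tsum_congr fun m => ?_) hs.tsum_eq) ?_)
  · have h1 : ((1 + c + m : ℝ) : ℂ) ≠ 0 := Complex.ofReal_ne_zero.mpr (by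
      have := Nat.cast_nonneg (α := ℝ) m
      linarith)
    have h2 : ((1 + μ * m : ℝ) : ℂ) ≠ 0 := Complex.ofReal_ne_zero.mpr (by positivity)
    have h3 : ((1 + ν * m : ℝ) : ℂ) ≠ 0 := Complex.ofReal_ne_zero.mpr (by positivity)
    have h4 : (c : ℂ) + ((m + 1 : ℕ) : ℂ) = 1 + c + m := by push_cast; ring
    unfold pascuCoeff
    rw [h4]
    push_cast at h1 h2 h3 ⊢
    generalize (1 + μ * m : ℂ) = P at *
    generalize (1 + ν * m : ℂ) = Q at *
    field_simp
    ring
  · rw [div_eq_zero_iff]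
    refine Or.inl (Eq.trans ?_ hzero)
    ring
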